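/- Let $k$ be a field of characteristic zero. An algebraic $k$-variety is a reduced separated scheme of finite type over $k$, and an algebraic group over $k$ is a group object in $k$-schemes whose underlying scheme is an algebraic $k$-variety. Let $G$ be an algebraic group over $k$. An action of $G$ on a $k$-variety $X$ is called good if for every point $x\in X$ the $G$-orbit of $x$ (the image of the fibre over $x$ of the projection $G\times_k X\to X$ under the action morphism $G\times_k X\to X$) is contained in an affine open subset of $X$. The $G$-equivariant Grothendieck ring $K_0^G(\mathrm{Var}_k)$ is the quotient of the free abelian group on the $G$-equivariant isomorphism classes $[X,\sigma]$ of $k$-varieties $X$ with a good $G$-action $\sigma$ by the relations $$[X,\sigma]=[Z,\sigma|_Z]+[X\setminus Z,\sigma|_{X\setminus Z}]$$ for every $\sigma$-invariant Zariski closed $Z\subseteq X$ such that the restricted actions are good, and $$[X\times_k\mathbb A^n_k,\sigma]=[X\times_k\mathbb A^n_k,\sigma']\qquad(n\in\mathbb N)$$ whenever $\sigma$ and $\sigma'$ are good actions lifting the same good $G$-action on $X$. Multiplication is induced by the product over $k$ with the diagonal action, and the unit is the class of $\operatorname{Spec}k$. Write $[X]$ for the class of $X$ with its given action, and $\mathbb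 L$ for the class of $\mathbb A^1_k$ with the trivial action (equivalently, with any good action). **Theorem.** Let $X$ and $Y$ be algebraic $k$-varieties endowed with good $G$-actions, and let $f\colon X\to Y$ be a $G$-equivariant morphism of $k$-schemes. Assume that the categorical quotient $Y\to Y/\!/G$ (in the category of $k$-schemes) exists and is quasi-finite, i.e. of finite type with finite fibres. Let $n\in\mathbb N$, and assume that for every point $y\in Y$, with residue field $k(y)$, there is an isomorphism of $k(y)$-schemes (not required to be compatible with any group action) between the scheme-theoretic fibre $X_y$ and $\mathbb A^n_{k(y)}$. Then $$[X]=[Y]\cdot\mathbb L^n\quad\text{in }K_0^G(\mathrm{Var}_k).$$ -/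

import Mathlib

open CategoryTheory MonoidalCategory CartesianMonoidalCategory MonObj AlgebraicGeometry Limits
open scoped ModObj MonoidalLeftAction TensorProduct

universe u

noncomputable section

namespace EquivariantK0

/-! ### Products of reduced schemes in characteristic zero

The facts of this section are only used to see that a product of two varieties is a variety. -/

theorem isReduced_tensor_aux1 (k P A Q E L : Type*) [Field k] [CharZero k] [CommRing P] [Field A]
    [Field Q] [Field E] [Field L] [Algebra k P] [Algebra k E] [Algebra k L]
    [Algebra P E] [IsScalarTower k P E] [Algebra P A] [IsFractionRing P A] [Algebra A E]
    [IsScalarTower P A E] [Algebra.IsAlgebraic A E] [Algebra.EssFiniteType k E]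
    [Algebra (P ⊗[k] L) Q] [IsFractionRing (P ⊗[k] L) Q] :
    IsReduced (E ⊗[k] L) := by
  let : Algebra P Q := ((algebraMap (P ⊗[k] L) Q).comp (algebraMap P (P ⊗[k] L))).toAlgebra
  have : IsScalarTower P (P ⊗[k] L) Q := .of_algebraMap_eq' rfl
  have : CharZero A :=
    charZero_of_injective_ringHom ((algebraMap P A).comp (algebraMap k P)).injective
  have : Algebra.FormallyUnramified A E := .of_isSeparable _ _
  have : Algebra.FormallyUnramified P A := .of_isLocalization (nonZeroDivisors P)
  have : Algebra.FormallyUnramified P E := .comp P A E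
  have : Algebra.EssFiniteType P E := .of_comp k P E
  have : Module.Flat P A := IsLocalization.flat _ (nonZeroDivisors P)
  have : Module.Flat P E := .trans P A E
  have : IsReduced (Q ⊗[P] E) := Algebra.FormallyUnramified.isReduced_of_field Q _
  have : IsReduced (E ⊗[P] Q) :=
    isReduced_of_injective _ (Algebra.TensorProduct.comm P E Q).injective
  have hinj : Function.Injective (Algebra.TensorProduct.map (AlgHom.id P E)
      (IsScalarTower.toAlgHom P (P ⊗[k] L) Q)) :=
    Module.Flat.lTensor_preserves_injective_linearMap
      (IsScalarTower.toAlgHom P (P ⊗[k] L) Q).toLinearMap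
      (IsFractionRing.injective (P ⊗[k] L) Q)
  have : IsReduced (E ⊗[P] (P ⊗[k] L)) := isReduced_of_injective _ hinj
  exact isReduced_of_injective _
    (Algebra.TensorProduct.cancelBaseChange k P P E L).symm.injective

theorem isReduced_tensor_aux (k E L : Type*) [Field k] [CharZero k] [Field E] [Field L]
    [Algebra k E] [Algebra k L] [Algebra.EssFiniteType k E] : IsReduced (E ⊗[k] L) := by
  obtain ⟨s, hs⟩ := exists_isTranscendenceBasis k E
  let P := Algebra.adjoin k (Set.range (Subtype.val : s → E))
  have : Algebra.IsAlgebraic P E := hs.isAlgebraic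
  have e : MvPolynomial s L ≃ₐ[L] L ⊗[k] P :=
    (MvPolynomial.algebraTensorAlgEquiv k L).symm.trans
      (Algebra.TensorProduct.congr AlgEquiv.refl hs.1.aevalEquiv)
  have e' : P ⊗[k] L ≃* MvPolynomial s L :=
    (Algebra.TensorProduct.comm k L P).symm.toMulEquiv.trans e.symm.toMulEquiv
  have : IsDomain (P ⊗[k] L) := e'.isDomain
  let : Algebra (FractionRing P) E := FractionRing.liftAlgebra P E
  have : IsScalarTower P (FractionRing P) E := FractionRing.isScalarTower_liftAlgebra P E
  have : Algebra.IsAlgebraic (FractionRing P) E :=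
    (IsFractionRing.comap_isAlgebraic_iff (A := P)).1 ‹_›
  exact isReduced_tensor_aux1 k P (FractionRing P) (FractionRing (P ⊗[k] L)) E L

theorem isReduced_tensor (k K L : Type*) [Field k] [CharZero k] [Field K] [Field L]
    [Algebra k K] [Algebra k L] : IsReduced (L ⊗[k] K) := by
  refine IsReduced.tensorProduct_of_flat_of_forall_fg fun B hB ↦ ?_
  obtain ⟨t, ht⟩ := hB
  let E := IntermediateField.adjoin k (t : Set K)
  have : Algebra.EssFiniteType k E :=
    IntermediateField.essFiniteType_iff.2 (IntermediateField.fg_adjoin_finset t)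
  have := isReduced_tensor_aux k E L
  have : IsReduced (L ⊗[k] E) :=
    isReduced_of_injective _ (Algebra.TensorProduct.comm k L E).injective
  have hBE : B ≤ E.toSubalgebra := ht ▸ IntermediateField.algebra_adjoin_le_adjoin k _
  exact isReduced_of_injective (Algebra.TensorProduct.map (AlgHom.id k L)
    (Subalgebra.inclusion hBE)) (Module.Flat.lTensor_preserves_injective_linearMap
      (Subalgebra.inclusion hBE).toLinearMap (Subalgebra.inclusion_injective hBE))

theorem isReduced_pullback {k : Type u} [Field k] [CharZero k] {X Y : Scheme.{u}}
    (f : X ⟶ Spec (.of k)) (g : Y ⟶ Spec (.of k)) [LocallyOfFiniteType f]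
    [LocallyOfFiniteType g]
    [IsReduced X] [IsReduced Y] : IsReduced (pullback f g) := by
  have hX : IsLocallyNoetherian X := LocallyOfFiniteType.isLocallyNoetherian f
  have hY : IsLocallyNoetherian Y := LocallyOfFiniteType.isLocallyNoetherian g
  have key : ∀ (K : Type u) [Field K] (a : Spec (.of K) ⟶ Spec (.of k)),
      GeometricallyReduced a := by
    intro K _ a
    refine ⟨fun L _ y Z fst snd h ↦ ?_⟩
    obtain ⟨φ, rfl⟩ := Spec.map_surjective a
    obtain ⟨ψ, rfl⟩ := Spec.map_surjective y
    algebraize [φ.hom, ψ.hom]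
    have := isReduced_tensor k L K
    have h2 := isPullback_SpecMap_of_isPushout _ _ _ _ (CommRingCat.isPushout_tensorProduct k K L)
    have e := h.isoIsPullback _ _ h2
    exact isReduced_of_isOpenImmersion e.hom
  have : GeometricallyReduced f := by
    refine ⟨fun K _ y Z fst snd h ↦ ?_⟩
    have := key K y
    have : IsReduced (pullback f y) := inferInstance
    exact isReduced_of_isOpenImmersion h.isoPullback.hom
  infer_instance

/-! ### Actions on products -/

section ModProd

variable {C : Type*} [Category C] [CartesianMonoidalCategory C] (G : C) [MonObj G]

/-- The diagonal action `g • (x, y) = (g • x, g • y)` of `G` on `X × Y`. -/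
@[reducible] def prodAction (X Y : C) [ModObj G X] [ModObj G Y] : ModObj G (X ⊗ Y) where
  smul := lift (G ◁ fst X Y ≫ γ[G, X]) (G ◁ snd X Y ≫ γ[G, Y])
  one_smul := by
    change η ▷ (X ⊗ Y) ≫ _ = (λ_ (X ⊗ Y)).hom
    ext
    · simp only [Category.assoc, lift_fst, ← whisker_exchange_assoc, ModObj.one_smul_self,
        leftUnitor_naturality]
    · simp only [Category.assoc, lift_snd, ← whisker_exchange_assoc, ModObj.one_smul_self,
        leftUnitor_naturality]
  mul_smul := by
    change μ ▷ (X ⊗ Y) ≫ _ = (α_ _ _ (X ⊗ Y)).hom ≫ G ◁ _ ≫ _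
    ext
    · simp only [Category.assoc, lift_fst, ← whisker_exchange_assoc, ModObj.mul_smul_self,
        ← MonoidalCategory.whiskerLeft_comp_assoc]
      simp
    · simp only [Category.assoc, lift_snd, ← whisker_exchange_assoc, ModObj.mul_smul_self,
        ← MonoidalCategory.whiskerLeft_comp_assoc]
      simp

variable {G}

theorem isModHom_prod {W X Y : C} [ModObj G W] [ModObj G X] [ModObj G Y] (f : W ⟶ X ⊗ Y)
    (h1 : IsModHom G (f ≫ fst X Y)) (h2 : IsModHom G (f ≫ snd X Y)) :
    @IsModHom _ _ _ _ _ _ G _ _ _ _ (prodAction G X Y) f := by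
  let := prodAction G X Y
  refine ⟨?_⟩
  change γ[G, W] ≫ f = G ◁ f ≫ lift (G ◁ fst X Y ≫ γ[G, X]) (G ◁ snd X Y ≫ γ[G, Y])
  have e1 : γ[G, W] ≫ f ≫ fst X Y = G ◁ (f ≫ fst X Y) ≫ γ[G, X] := h1.smul_hom
  have e2 : γ[G, W] ≫ f ≫ snd X Y = G ◁ (f ≫ snd X Y) ≫ γ[G, Y] := h2.smul_hom
  ext
  · simp [e1]
  · simp [e2]

theorem isModHom_fst {X Y : C} [ModObj G X] [ModObj G Y] :
    @IsModHom _ _ _ _ _ _ G _ _ _ (prodAction G X Y) _ (fst X Y) :=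
  let := prodAction G X Y
  ⟨lift_fst _ _⟩

theorem isModHom_snd {X Y : C} [ModObj G X] [ModObj G Y] :
    @IsModHom _ _ _ _ _ _ G _ _ _ (prodAction G X Y) _ (snd X Y) :=
  let := prodAction G X Y
  ⟨lift_snd _ _⟩

theorem isModHom_tensor {X Y X' Y' : C} [ModObj G X] [ModObj G Y] [ModObj G X'] [ModObj G Y']
    (f : X ⟶ X') (g : Y ⟶ Y') (hf : IsModHom G f) (hg : IsModHom G g) :
    @IsModHom _ _ _ _ _ _ G _ _ _ (prodAction G X Y) (prodAction G X' Y') (f ⊗ₘ g) := by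
  let := prodAction G X Y
  have := isModHom_fst (G := G) (X := X) (Y := Y)
  have := isModHom_snd (G := G) (X := X) (Y := Y)
  refine isModHom_prod _ ?_ ?_
  · rw [tensorHom_fst]; infer_instance
  · rw [tensorHom_snd]; infer_instance

theorem isModHom_swap [BraidedCategory C] {X Y : C} [ModObj G X] [ModObj G Y] :
    @IsModHom _ _ _ _ _ _ G _ _ _ (prodAction G X Y) (prodAction G Y X) (β_ X Y).hom := by
  let := prodAction G X Y
  refine isModHom_prod _ ?_ ?_
  · rw [CartesianMonoidalCategory.braiding_hom_fst]; exact isModHom_snd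
  · rw [CartesianMonoidalCategory.braiding_hom_snd]; exact isModHom_fst

theorem isModHom_associator {X Y Z : C} [ModObj G X] [ModObj G Y] [ModObj G Z] :
    letI := prodAction G X Y
    letI := prodAction G Y Z
    @IsModHom _ _ _ _ _ _ G _ _ _ (prodAction G (X ⊗ Y) Z) (prodAction G X (Y ⊗ Z))
      (α_ X Y Z).hom := by
  let := prodAction G X Y
  let := prodAction G Y Z
  let := prodAction G (X ⊗ Y) Z
  have := isModHom_fst (G := G) (X := X) (Y := Y)
  have := isModHom_snd (G := G) (X := X) (Y := Y)
  have := isModHom_fst (G := G) (X := X ⊗ Y) (Y := Z)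
  have := isModHom_snd (G := G) (X := X ⊗ Y) (Y := Z)
  refine isModHom_prod _ ?_ (isModHom_prod _ ?_ ?_)
  · rw [associator_hom_fst]; infer_instance
  · rw [Category.assoc, associator_hom_snd_fst]; infer_instance
  · rw [Category.assoc, associator_hom_snd_snd]; infer_instance

theorem isModHom_rightUnitor {X : C} [ModObj G X] [ModObj G (𝟙_ C)] :
    @IsModHom _ _ _ _ _ _ G _ _ _ (prodAction G X (𝟙_ C)) _ (ρ_ X).hom := by
  rw [rightUnitor_hom]; exact isModHom_fst

end ModProd

/-! ### Varieties with good group actions -/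

section Varieties

variable {k : Type u} [Field k]

/-- An algebraic variety over `k`: a reduced separated scheme of finite type over `k`
(not necessarily irreducible, possibly empty). -/
structure IsVariety (X : Over (Spec (.of k))) : Prop where
  isReduced : IsReduced X.left
  isSeparated : IsSeparated X.hom
  locallyOfFiniteType : LocallyOfFiniteType X.hom
  quasiCompact : QuasiCompact X.hom

theorem IsVariety.prod [CharZero k] {X Y : Over (Spec (.of k))} (hX : IsVariety X)
    (hY : IsVariety Y) : IsVariety (X ⊗ Y) := by
  obtain ⟨_, _, _, _⟩ := hX
  obtain ⟨_, _, _, _⟩ := hY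
  refine ⟨isReduced_pullback X.hom Y.hom, ?_, ?_, ?_⟩ <;>
    (rw [Over.tensorObj_hom]; infer_instance)

theorem isReduced_affineSpace (n : Type u) :
    IsReduced 𝔸(n; Spec (.of k)) :=
  isReduced_of_isOpenImmersion (AffineSpace.SpecIso n (.of k)).hom

theorem IsVariety.point : IsVariety (𝟙_ (Over (Spec (.of k)))) := by
  refine ⟨?_, ?_, ?_, ?_⟩
  · rw [Over.tensorUnit_left]; infer_instance
  · exact inferInstanceAs (IsSeparated (𝟙 (Spec (.of k))))
  · exact inferInstanceAs (LocallyOfFiniteType (𝟙 (Spec (.of k))))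
  · exact inferInstanceAs (QuasiCompact (𝟙 (Spec (.of k))))

/-- An algebraic group over `k`: a group object in `k`-schemes whose underlying scheme is an
algebraic variety. -/
class IsAlgebraicGroup (G : Over (Spec (.of k))) [GrpObj G] : Prop where
  isVariety : IsVariety G

variable (G : Over (Spec (.of k))) [GrpObj G]

/-- The orbit of a point `x` of the scheme `X`: the image of `G × {x}`, that is of the fibre over
`x` of the projection `G × X ⟶ X`, under the action morphism `G × X ⟶ X`. -/
def orbit {X : Over (Spec (.of k))} [ModObj G X] (x : X.left) : Set X.left :=
  γ[G, X].left '' ((snd G X).left ⁻¹' {x})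

/-- An action is good if every orbit is contained in an affine open subset. -/
def IsGoodAction (X : Over (Spec (.of k))) [ModObj G X] : Prop :=
  ∀ x : X.left, ∃ U : X.left.Opens, IsAffineOpen U ∧ orbit G x ⊆ U

/-- An algebraic `k`-variety endowed with a good action of `G`. -/
structure GVariety where
  /-- the underlying `k`-scheme -/
  obj : Over (Spec (.of k))
  /-- the action `G × X ⟶ X` -/
  [act : ModObj G obj]
  isVariety : IsVariety obj
  good : IsGoodAction G obj

attribute [instance] GVariety.act

variable {G}

theorem isAffineOpen_prod {X Y : Over (Spec (.of k))} {U : X.left.Opens} {V : Y.left.Opens}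
    (hU : IsAffineOpen U) (hV : IsAffineOpen V) :
    IsAffineOpen ((fst X Y).left ⁻¹ᵁ U ⊓ (snd X Y).left ⁻¹ᵁ V) := by
  have : IsAffine U := hU
  have : IsAffine V := hV
  let m := pullback.map (U.ι ≫ X.hom) (V.ι ≫ Y.hom) X.hom Y.hom U.ι V.ι (𝟙 _)
    (by simp) (by simp)
  have h : m.opensRange = (fst X Y).left ⁻¹ᵁ U ⊓ (snd X Y).left ⁻¹ᵁ V := by
    apply TopologicalSpace.Opens.ext
    have := Scheme.Pullback.range_map (U.ι ≫ X.hom) (V.ι ≫ Y.hom) X.hom Y.hom U.ι V.ι (𝟙 _)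
      (by simp) (by simp)
    simpa using this
  exact h ▸ isAffineOpen_opensRange m

theorem IsGoodAction.prod {X Y : Over (Spec (.of k))} [ModObj G X] [ModObj G Y]
    (hX : IsGoodAction G X) (hY : IsGoodAction G Y) :
    @IsGoodAction k _ G _ (X ⊗ Y) (prodAction G X Y) := by
  let := prodAction G X Y
  intro p
  obtain ⟨U, hU, hxU⟩ := hX ((fst X Y).left p)
  obtain ⟨V, hV, hyV⟩ := hY ((snd X Y).left p)
  refine ⟨(fst X Y).left ⁻¹ᵁ U ⊓ (snd X Y).left ⁻¹ᵁ V, ?_, ?_⟩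
  · exact isAffineOpen_prod hU hV
  · rintro _ ⟨z, hz, rfl⟩
    have h1 : γ[G, X ⊗ Y] ≫ fst X Y = G ◁ fst X Y ≫ γ[G, X] := lift_fst _ _
    have h2 : γ[G, X ⊗ Y] ≫ snd X Y = G ◁ snd X Y ≫ γ[G, Y] := lift_snd _ _
    have hz' : (snd G (X ⊗ Y)).left z = p := hz
    refine ⟨hxU ?_, hyV ?_⟩
    · refine ⟨(G ◁ fst X Y).left z, ?_, ?_⟩
      · rw [Set.mem_preimage, Set.mem_singleton_iff, ← hz', ← Scheme.Hom.comp_apply,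
          ← Scheme.Hom.comp_apply, ← Over.comp_left, ← Over.comp_left, whiskerLeft_snd]
      · rw [← Scheme.Hom.comp_apply, ← Scheme.Hom.comp_apply, ← Over.comp_left,
          ← Over.comp_left, h1]
    · refine ⟨(G ◁ snd X Y).left z, ?_, ?_⟩
      · rw [Set.mem_preimage, Set.mem_singleton_iff, ← hz', ← Scheme.Hom.comp_apply,
          ← Scheme.Hom.comp_apply, ← Over.comp_left, ← Over.comp_left, whiskerLeft_snd]
      · rw [← Scheme.Hom.comp_apply, ← Scheme.Hom.comp_apply, ← Over.comp_left,
          ← Over.comp_left, h2]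

theorem IsGoodAction.of_isAffine {X : Over (Spec (.of k))} [ModObj G X] [IsAffine X.left] :
    IsGoodAction G X :=
  fun _ ↦ ⟨⊤, isAffineOpen_top _, fun _ _ ↦ trivial⟩

namespace GVariety

/-- The product `X × Y` over `k` with the diagonal action. -/
def prod [CharZero k] (X Y : GVariety G) : GVariety G where
  obj := X.obj ⊗ Y.obj
  act := prodAction G X.obj Y.obj
  isVariety := X.isVariety.prod Y.isVariety
  good := X.good.prod Y.good

variable (G) in
/-- `Spec k` with the trivial action. -/
def point : GVariety G where
  obj := 𝟙_ _
  act := ModObj.trivialAction G _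
  isVariety := .point
  good := by
    have : IsAffine (𝟙_ (Over (Spec (.of k)))).left := by
      rw [Over.tensorUnit_left]; infer_instance
    exact @IsGoodAction.of_isAffine _ _ _ _ _ (_) _

variable (G) in
/-- The affine line over `k` with the trivial action. -/
def affineLine : GVariety G where
  obj := Over.mk (𝔸(ULift.{u} (Fin 1); Spec (.of k)) ↘ Spec (.of k))
  act := ModObj.trivialAction G _
  isVariety := ⟨isReduced_affineSpace _,
    inferInstanceAs (IsSeparated (𝔸(ULift.{u} (Fin 1); Spec (.of k)) ↘ Spec (.of k))),
    inferInstanceAs (LocallyOfFiniteType (𝔸(ULift.{u} (Fin 1); Spec (.of k)) ↘ Spec (.of k))),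
    inferInstanceAs (QuasiCompact (𝔸(ULift.{u} (Fin 1); Spec (.of k)) ↘ Spec (.of k)))⟩
  good := by
    have : IsAffine (Over.mk (𝔸(ULift.{u} (Fin 1); Spec (.of k)) ↘ Spec (.of k))).left :=
      inferInstanceAs (IsAffine 𝔸(ULift.{u} (Fin 1); Spec (.of k)))
    exact @IsGoodAction.of_isAffine _ _ _ _ _ (_) _

/-- `X` and `Y` are `G`-equivariantly isomorphic over `k`. -/
def Equivalent (X Y : GVariety G) : Prop :=
  ∃ e : X.obj ≅ Y.obj, IsModHom G e.hom

theorem Equivalent.equivalence : Equivalence (Equivalent (G := G)) where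
  refl X := ⟨Iso.refl _, inferInstanceAs (IsModHom G (𝟙 X.obj))⟩
  symm := fun ⟨e, _⟩ ↦ ⟨e.symm, inferInstanceAs (IsModHom G e.inv)⟩
  trans := fun ⟨e, _⟩ ⟨e', _⟩ ↦ ⟨e ≪≫ e', inferInstanceAs (IsModHom G (e.hom ≫ e'.hom))⟩

instance setoid : Setoid (GVariety G) := ⟨Equivalent, Equivalent.equivalence⟩

section Product

variable [CharZero k]

theorem prod_congr {X X' Y Y' : GVariety G} (hX : X ≈ X') (hY : Y ≈ Y') :
    X.prod Y ≈ X'.prod Y' := by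
  obtain ⟨e, he⟩ := hX
  obtain ⟨e', he'⟩ := hY
  exact ⟨e ⊗ᵢ e', isModHom_tensor _ _ he he'⟩

theorem prod_comm (X Y : GVariety G) : X.prod Y ≈ Y.prod X :=
  ⟨β_ X.obj Y.obj, isModHom_swap⟩

theorem prod_assoc (X Y Z : GVariety G) : (X.prod Y).prod Z ≈ X.prod (Y.prod Z) :=
  ⟨α_ X.obj Y.obj Z.obj, isModHom_associator⟩

theorem prod_point (X : GVariety G) : X.prod (point G) ≈ X :=
  let : ModObj G (𝟙_ (Over (Spec (.of k)))) := (point G).act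
  ⟨ρ_ X.obj, isModHom_rightUnitor⟩

end Product

end GVariety

/-- The set of `G`-equivariant isomorphism classes of `k`-varieties with good `G`-action. -/
def IsoClass (G : Over (Spec (.of k))) [GrpObj G] : Type (u + 1) :=
  Quotient (GVariety.setoid (G := G))

/-- The isomorphism class of `X`. -/
def GVariety.isoClass (X : GVariety G) : IsoClass G := Quotient.mk _ X

variable (G) in
/-- `φ : Y ⟶ Q` is a categorical quotient of `Y` by `G`: it is `G`-invariant, and every
`G`-invariant morphism of `k`-schemes from `Y` factors uniquely through it. -/
structure IsCategoricalQuotient {Y Q : Over (Spec (.of k))} [ModObj G Y] (φ : Y ⟶ Q) : Prop where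
  invariant : γ[G, Y] ≫ φ = snd G Y ≫ φ
  existsUnique : ∀ (Z : Over (Spec (.of k))) (ψ : Y ⟶ Z), γ[G, Y] ≫ ψ = snd G Y ≫ ψ →
    ∃! χ : Q ⟶ Z, φ ≫ χ = ψ

variable [CharZero k]

/-- Isomorphism classes form a commutative monoid under the product over `k` with the diagonal
action. -/
instance : CommMonoid (IsoClass G) where
  mul := Quotient.map₂ GVariety.prod fun _ _ h _ _ h' ↦ GVariety.prod_congr h h'
  one := (GVariety.point G).isoClass
  mul_assoc := by
    rintro ⟨X⟩ ⟨Y⟩ ⟨Z⟩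
    exact Quotient.sound (GVariety.prod_assoc X Y Z)
  mul_comm := by
    rintro ⟨X⟩ ⟨Y⟩
    exact Quotient.sound (GVariety.prod_comm X Y)
  mul_one := by
    rintro ⟨X⟩
    exact Quotient.sound (GVariety.prod_point X)
  one_mul := by
    rintro ⟨X⟩
    exact Quotient.sound (Setoid.trans (GVariety.prod_comm _ X) (GVariety.prod_point X))

/-- The generator `[X]` of the free abelian group on isomorphism classes. -/
def GVariety.free (X : GVariety G) : MonoidAlgebra ℤ (IsoClass G) :=
  MonoidAlgebra.of ℤ (IsoClass G) X.isoClass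

/-- The underlying `k`-scheme of `E` is isomorphic over `X` to `X × 𝔸ⁿ`. No compatibility of the
isomorphism with the actions is required. -/
def IsTrivialAffineBundle (n : ℕ) {E X : Scheme.{u}} (p : E ⟶ X) : Prop :=
  Nonempty (Over.mk p ≅ Over.mk (𝔸(ULift.{u} (Fin n); X) ↘ X))

variable (G) in
/-- The scissor relators `[X] - [Z] - [X ∖ Z]` for `G`-invariant closed subvarieties `Z` of `X`,
given by equivariant closed and open immersions with complementary images. -/
def scissorRelators : Set (MonoidAlgebra ℤ (IsoClass G)) :=
  {r | ∃ (X Z U : GVariety G) (i : Z.obj ⟶ X.obj) (j : U.obj ⟶ X.obj),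
    IsModHom G i ∧ IsModHom G j ∧ IsClosedImmersion i.left ∧ IsOpenImmersion j.left ∧
    Set.range j.left = (Set.range i.left)ᶜ ∧ r = X.free - Z.free - U.free}

variable (G) in
/-- The relators `[X × 𝔸ⁿ, σ] - [X × 𝔸ⁿ, σ']` for two good actions `σ`, `σ'` on `X × 𝔸ⁿ` lifting
the same good action on `X`. -/
def affineRelators : Set (MonoidAlgebra ℤ (IsoClass G)) :=
  {r | ∃ (n : ℕ) (X E E' : GVariety G) (p : E.obj ⟶ X.obj) (p' : E'.obj ⟶ X.obj),
    IsModHom G p ∧ IsModHom G p' ∧ IsTrivialAffineBundle n p.left ∧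
    IsTrivialAffineBundle n p'.left ∧ r = E.free - E'.free}

variable (G) in
/-- The equivariant Grothendieck ring `K₀ᴳ(Var_k)`: the free abelian group on the isomorphism
classes of `k`-varieties with good `G`-action, with the multiplication induced by the product over
`k`, modulo the scissor relators and the affine relators. (Both sets of relators are stable under
multiplication by a generator, so the additive subgroup they generate is this ideal.) -/
def K0 : Type (u + 1) :=
  MonoidAlgebra ℤ (IsoClass G) ⧸ Ideal.span (scissorRelators G ∪ affineRelators G)

instance : CommRing (K0 G) :=
  inferInstanceAs (CommRing (_ ⧸ Ideal.span (scissorRelators G ∪ affineRelators G)))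

/-- The class `[X]` in `K₀ᴳ(Var_k)`. -/
def GVariety.cls (X : GVariety G) : K0 G := Ideal.Quotient.mk _ X.free

variable (G) in
/-- `𝕃 = [𝔸¹]` in `K₀ᴳ(Var_k)`; by the affine relators it does not depend on the good action
chosen on `𝔸¹`, and we take the trivial one. -/
def lefschetz : K0 G := (GVariety.affineLine G).cls

end Varieties

/-- A quasi-finite morphism of schemes: of finite type with finite fibres. -/
structure IsQuasiFinite {Y Q : Scheme.{u}} (φ : Y ⟶ Q) : Prop where
  locallyOfFiniteType : LocallyOfFiniteType φ
  quasiCompact : QuasiCompact φ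
  finite_fiber : ∀ q : Q, (φ ⁻¹' {q}).Finite

end EquivariantK0

end

/-! The proof is a Noetherian induction on `Y`: trivialise `f` near generic points, but cut the
pieces out of `Q`, so that they are stable under `G`.

At a generic point `y` of the reduced scheme `Y` the local ring is a field, so the fibre of `f` at
`y` is the base change of `f` to `Spec 𝒪_{Y, y}`. This spectrum is the limit of the affine
neighbourhoods of `y`, and `f` is finitely presented, so the isomorphism of the fibre with `𝔸ⁿ`
extends over a neighbourhood of `y` (`exists_isTrivialAffineBundle_morphismRestrict_of_fiber`).

Such a neighbourhood need not be invariant, whereas preimages under `φ` are. Choose a generic point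
whose image in `Q` has no proper generization among the images of generic points. Its fibre under
`φ` is then a finite set of generic points of `Y`. They have disjoint neighbourhoods over which `f`
is trivial, and the union of these contains `φ⁻¹ W` for an open `W` meeting the image
(`exists_opens_preimage_of_finite_fiber`).

Over `φ⁻¹ W` the map `f` is an equivariant map whose trivialisation ignores the action. The affine
relators identify its class with that of the product with `𝔸ⁿ`
(`GVariety.cls_eq_mul_lefschetz_pow`). The reduced closed complement satisfies the same hypotheses,
because the reduced structure does not alter fibres that are affine spaces
(`isTrivialAffineBundle_fiber_of_isClosedImmersion`). The scissor relators add up the two pieces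
(`cls_eq_of_isClosedEmbedding`). -/

noncomputable section

namespace EquivariantK0

/-! ### Spreading out isomorphisms -/

/-! ### Descending isomorphisms from a cofiltered limit to a finite stage. -/

section SpreadCategory

variable {C : Type*} [Category C] [CartesianMonoidalCategory C] {I : Type*} [Category I]
  [IsCofiltered I] {D : I ⥤ C} {c : Cone D}

/-- Multiplication by a fixed object preserves cofiltered limits. -/
def isLimitTensorLeft (hc : IsLimit c) (X : C) : IsLimit ((tensorLeft X).mapCone c) :=
  have hfst (s : Cone (D ⋙ tensorLeft X)) (i j : I) :
      s.π.app i ≫ fst X (D.obj i) = s.π.app j ≫ fst X (D.obj j) := by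
    have h (a b : I) (f : a ⟶ b) :
        s.π.app a ≫ fst X (D.obj a) = s.π.app b ≫ fst X (D.obj b) := by
      rw [← s.w f]; simp
    exact (h _ _ (IsCofiltered.minToLeft i j)).symm.trans (h _ _ (IsCofiltered.minToRight i j))
  let sndCone (s : Cone (D ⋙ tensorLeft X)) : Cone D :=
    { pt := s.pt
      π := { app i := s.π.app i ≫ snd X (D.obj i)
             naturality i j f := by
              have := s.w f
              simp only [Functor.const_obj_obj, Functor.const_obj_map, Category.id_comp]
              rw [← this]; simp } }
  have i₀ : I := IsCofiltered.nonempty.some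
  { lift s := lift (s.π.app i₀ ≫ fst X (D.obj i₀)) (hc.lift (sndCone s))
    fac s i := by
      refine CartesianMonoidalCategory.hom_ext _ _ ?_ ?_
      · simp [hfst s i₀ i]
      · simp [sndCone]
    uniq s m hm := by
      refine CartesianMonoidalCategory.hom_ext _ _ ?_ (hc.hom_ext fun i ↦ ?_)
      · simp [← hm i₀]
      · simp [sndCone, ← hm i] }

/-- An isomorphism over a cofiltered limit between constant families of objects which are finitely
presented relative to the diagram already exists at a finite stage. -/
theorem exists_iso_of_isLimit (hc : IsLimit c) (X Z : C)
    [PreservesColimit (D ⋙ tensorLeft X).op (yoneda.obj X)]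
    [PreservesColimit (D ⋙ tensorLeft X).op (yoneda.obj Z)]
    [PreservesColimit (D ⋙ tensorLeft Z).op (yoneda.obj X)]
    [PreservesColimit (D ⋙ tensorLeft Z).op (yoneda.obj Z)]
    (e : X ⊗ c.pt ≅ Z ⊗ c.pt) (he : e.hom ≫ snd _ _ = snd _ _) :
    ∃ (i : I) (e' : X ⊗ D.obj i ≅ Z ⊗ D.obj i), e'.hom ≫ snd _ _ = snd _ _ := by
  have he' : e.inv ≫ snd _ _ = snd _ _ := by rw [← he, Iso.inv_hom_id_assoc]
  obtain ⟨i, a, ha⟩ := exists_hom_of_preservesColimit_yoneda (isLimitTensorLeft hc X)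
    (e.hom ≫ fst _ _)
  obtain ⟨j, b, hb⟩ := exists_hom_of_preservesColimit_yoneda (isLimitTensorLeft hc Z)
    (e.inv ≫ fst _ _)
  let l := IsCofiltered.min i j
  let p : l ⟶ i := IsCofiltered.minToLeft i j
  let q : l ⟶ j := IsCofiltered.minToRight i j
  -- `A` and `B` are the descended first components of `e.hom` and `e.inv`, paired with the
  -- projection to the base. They exist at every stage beyond `l`, but become mutually inverse only
  -- later.
  let A (m : I) (f : m ⟶ l) : X ⊗ D.obj m ⟶ Z ⊗ D.obj m :=
    lift (X ◁ D.map (f ≫ p) ≫ a) (snd _ _)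
  let B (m : I) (f : m ⟶ l) : Z ⊗ D.obj m ⟶ X ⊗ D.obj m :=
    lift (Z ◁ D.map (f ≫ q) ≫ b) (snd _ _)
  have hA (m : I) (f : m ⟶ l) : X ◁ c.π.app m ≫ A m f = e.hom ≫ Z ◁ c.π.app m := by
    refine CartesianMonoidalCategory.hom_ext _ _ ?_ ?_
    · simp only [A, Category.assoc, lift_fst, whiskerLeft_fst, ← ha]
      rw [← MonoidalCategory.whiskerLeft_comp_assoc, c.w]; rfl
    · simp only [A, Category.assoc, lift_snd, whiskerLeft_snd, reassoc_of% he]; rfl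
  have hB (m : I) (f : m ⟶ l) : Z ◁ c.π.app m ≫ B m f = e.inv ≫ X ◁ c.π.app m := by
    refine CartesianMonoidalCategory.hom_ext _ _ ?_ ?_
    · simp only [B, Category.assoc, lift_fst, whiskerLeft_fst, ← hb]
      rw [← MonoidalCategory.whiskerLeft_comp_assoc, c.w]; rfl
    · simp only [B, Category.assoc, lift_snd, whiskerLeft_snd, reassoc_of% he']; rfl
  have nA (m : I) (f : m ⟶ l) : X ◁ D.map f ≫ A l (𝟙 l) = A m f ≫ Z ◁ D.map f := by
    refine CartesianMonoidalCategory.hom_ext _ _ ?_ ?_ <;> simp [A]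
  have nB (m : I) (f : m ⟶ l) : Z ◁ D.map f ≫ B l (𝟙 l) = B m f ≫ X ◁ D.map f := by
    refine CartesianMonoidalCategory.hom_ext _ _ ?_ ?_ <;> simp [B]
  obtain ⟨m, f, hf⟩ := exists_eq_of_preservesColimit_yoneda_self (isLimitTensorLeft hc X)
    (i := l) (X := X) (A l (𝟙 l) ≫ B l (𝟙 l) ≫ fst _ _) (fst _ _) (by
      change X ◁ c.π.app l ≫ _ = X ◁ c.π.app l ≫ _
      rw [reassoc_of% (hA l (𝟙 l)), reassoc_of% (hB l (𝟙 l)), Iso.hom_inv_id_assoc])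
  obtain ⟨m', f', hf'⟩ := exists_eq_of_preservesColimit_yoneda_self (isLimitTensorLeft hc Z)
    (i := l) (X := Z) (B l (𝟙 l) ≫ A l (𝟙 l) ≫ fst _ _) (fst _ _) (by
      change Z ◁ c.π.app l ≫ _ = Z ◁ c.π.app l ≫ _
      rw [reassoc_of% (hB l (𝟙 l)), reassoc_of% (hA l (𝟙 l)), Iso.inv_hom_id_assoc])
  -- The two identities hold at different stages `m` and `m'`. At `r` both hold, and both refer to
  -- the same map to `l`.
  obtain ⟨r, g, g', hg⟩ := IsCofiltered.cospan f f'
  change X ◁ D.map f ≫ _ = X ◁ D.map f ≫ _ at hf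
  change Z ◁ D.map f' ≫ _ = Z ◁ D.map f' ≫ _ at hf'
  refine ⟨r, ⟨A r (g ≫ f), B r (g ≫ f), ?_, ?_⟩, lift_snd _ _⟩
  · refine CartesianMonoidalCategory.hom_ext _ _ ?_ (by simp [A, B])
    have h1 : A r (g ≫ f) ≫ B r (g ≫ f) ≫ fst _ _ =
        X ◁ D.map (g ≫ f) ≫ A l (𝟙 l) ≫ B l (𝟙 l) ≫ fst _ _ := by
      rw [reassoc_of% (nA r (g ≫ f)), reassoc_of% (nB r (g ≫ f)), whiskerLeft_fst]
    rw [Category.assoc, h1, D.map_comp, MonoidalCategory.whiskerLeft_comp_assoc, hf]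
    simp
  · refine CartesianMonoidalCategory.hom_ext _ _ ?_ (by simp [A, B])
    have h1 : B r (g ≫ f) ≫ A r (g ≫ f) ≫ fst _ _ =
        Z ◁ D.map (g ≫ f) ≫ B l (𝟙 l) ≫ A l (𝟙 l) ≫ fst _ _ := by
      rw [reassoc_of% (nB r (g ≫ f)), reassoc_of% (nA r (g ≫ f)), whiskerLeft_fst]
    rw [Category.assoc, h1, hg, D.map_comp, MonoidalCategory.whiskerLeft_comp_assoc, hf']
    simp

end SpreadCategory

/-! ### `Spec` of a local ring as the limit of affine neighbourhoods. -/

section FactorStalk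

/-- A function that is invertible at `y` is invertible at every generization of `y`, so its pullback
to `T` is a unit. The universal property of localization then extends the ring map to the stalk. -/
theorem exists_comp_fromSpecStalk_of_isAffine {T Y : Scheme.{u}} [IsAffine Y] (g : T ⟶ Y) (y : Y)
    (hg : ∀ t, g t ⤳ y) : ∃ l : T ⟶ Spec (Y.presheaf.stalk y), l ≫ Y.fromSpecStalk y = g := by
  let := (Y.presheaf.germ ⊤ y trivial).hom.toAlgebra
  have : IsLocalization.AtPrime (Y.presheaf.stalk y)
      ((isAffineOpen_top Y).primeIdealOf ⟨y, trivial⟩).asIdeal :=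
    (isAffineOpen_top Y).isLocalization_stalk ⟨y, trivial⟩
  have hu (s : ((isAffineOpen_top Y).primeIdealOf ⟨y, trivial⟩).asIdeal.primeCompl) :
      IsUnit (g.appTop.hom s.1) := by
    have h1 : IsUnit (Y.presheaf.germ ⊤ y trivial s.1) :=
      IsLocalization.map_units (Y.presheaf.stalk y) s
    have h2 : y ∈ Y.basicOpen s.1 := (Y.mem_basicOpen_top _ _).2 h1
    refine T.toRingedSpace.isUnit_of_isUnit_germ ⊤ _ fun t ht ↦ ?_
    have h3 : t ∈ g ⁻¹ᵁ Y.basicOpen s.1 := (hg t).mem_open (Y.basicOpen s.1).2 h2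
    rw [Scheme.preimage_basicOpen_top] at h3
    exact (T.mem_basicOpen_top _ _).1 h3
  let ψ : Y.presheaf.stalk y ⟶ Γ(T, ⊤) := CommRingCat.ofHom (IsLocalization.lift
    (S := Y.presheaf.stalk y) (M := ((isAffineOpen_top Y).primeIdealOf ⟨y, trivial⟩).asIdeal.primeCompl) hu)
  have hψ : Y.presheaf.germ ⊤ y trivial ≫ ψ = g.appTop := by
    ext s
    exact IsLocalization.lift_eq (S := Y.presheaf.stalk y)
      (M := ((isAffineOpen_top Y).primeIdealOf ⟨y, trivial⟩).asIdeal.primeCompl) hu s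
  refine ⟨T.toSpecΓ ≫ Spec.map ψ, ?_⟩
  rw [← cancel_mono Y.toSpecΓ, Category.assoc, Category.assoc, Scheme.fromSpecStalk_toSpecΓ,
    ← Spec.map_comp, hψ, Scheme.toSpecΓ_naturality]

/-- A morphism whose image consists of generizations of `y` factors through `Spec 𝒪_{Y, y}`. -/
theorem exists_comp_fromSpecStalk {T Y : Scheme.{u}} (g : T ⟶ Y) (y : Y)
    (hg : ∀ t, g t ⤳ y) : ∃ l : T ⟶ Spec (Y.presheaf.stalk y), l ≫ Y.fromSpecStalk y = g := by
  obtain ⟨U, hU, hyU, -⟩ := exists_isAffineOpen_mem_and_subset (X := Y) (U := ⊤) (x := y) trivial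
  have : IsAffine U := hU
  have hr : Set.range g ⊆ Set.range U.ι := by
    rintro _ ⟨t, rfl⟩
    simpa using (hg t).mem_open U.2 hyU
  obtain ⟨l, hl⟩ := exists_comp_fromSpecStalk_of_isAffine (IsOpenImmersion.lift U.ι g hr)
    (⟨y, hyU⟩ : U) fun t ↦ by
      refine U.ι.isOpenEmbedding.isInducing.specializes_iff.1 ?_
      rw [← Scheme.Hom.comp_apply, IsOpenImmersion.lift_fac]
      exact hg t
  refine ⟨l ≫ Spec.map (U.ι.stalkMap ⟨y, hyU⟩), ?_⟩
  have h := Scheme.SpecMap_stalkMap_fromSpecStalk U.ι (x := ⟨y, hyU⟩)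
  change Spec.map _ ≫ Y.fromSpecStalk y = _ at h
  rw [Category.assoc, h, reassoc_of% hl, IsOpenImmersion.lift_fac]

/-- The category of affine open neighbourhoods of a point. -/
abbrev AffineNhds {Y : Scheme.{u}} (y : Y) : Type u := {U : Y.Opens // IsAffineOpen U ∧ y ∈ U}

instance {Y : Scheme.{u}} (y : Y) : IsCofiltered (AffineNhds y) := by
  have : Nonempty (AffineNhds y) := by
    obtain ⟨U, hU, hyU, -⟩ := exists_isAffineOpen_mem_and_subset (X := Y) (U := ⊤) (x := y) trivial
    exact ⟨U, hU, hyU⟩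
  have : IsCodirectedOrder (AffineNhds y) := ⟨fun U V ↦ by
    obtain ⟨W, hW, hyW, h⟩ := exists_isAffineOpen_mem_and_subset (X := Y) (U := U.1 ⊓ V.1) (x := y)
      ⟨U.2.2, V.2.2⟩
    exact ⟨⟨W, hW, hyW⟩, fun _ hx ↦ (h hx).1, fun _ hx ↦ (h hx).2⟩⟩
  infer_instance

/-- The diagram of affine open neighbourhoods of a point. -/
def affineNhdsDiagram {Y : Scheme.{u}} (y : Y) : AffineNhds y ⥤ Over Y :=
  Monotone.functor (f := fun U : AffineNhds y ↦ U.1) (fun _ _ h ↦ h) ⋙ Y.restrictFunctor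

/-- The cone of `Spec 𝒪_{Y, y}` over the diagram of affine open neighbourhoods of `y`. -/
def stalkCone {Y : Scheme.{u}} (y : Y) : Cone (affineNhdsDiagram y) where
  pt := Over.mk (Y.fromSpecStalk y)
  π :=
    { app U := Over.homMk (U.1.fromSpecStalkOfMem y U.2.2)
        (Scheme.Opens.fromSpecStalkOfMem_ι U.1 y U.2.2)
      naturality U V i := by
        ext1
        change 𝟙 _ ≫ V.1.fromSpecStalkOfMem y V.2.2 =
          U.1.fromSpecStalkOfMem y U.2.2 ≫ Y.homOfLE (leOfHom i)
        rw [← cancel_mono V.1.ι]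
        simp }

/-- `Spec 𝒪_{Y, y}` is the limit of the affine open neighbourhoods of `y`. -/
def isLimitStalkCone {Y : Scheme.{u}} (y : Y) : IsLimit (stalkCone y) :=
  have key (s : Cone (affineNhdsDiagram y)) (t : s.pt.left) : s.pt.hom t ⤳ y := by
    rw [specializes_iff_forall_open]
    intro W hW hy
    obtain ⟨U, hU, hyU, h⟩ := exists_isAffineOpen_mem_and_subset (X := Y) (U := ⟨W, hW⟩) (x := y) hy
    have := Over.w (s.π.app ⟨U, hU, hyU⟩)
    change (s.π.app ⟨U, hU, hyU⟩).left ≫ U.ι = s.pt.hom at this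
    rw [← this]
    exact h ((s.π.app ⟨U, hU, hyU⟩).left t).2
  have lift (s : Cone (affineNhdsDiagram y)) :
      ∃ l : s.pt ⟶ (stalkCone y).pt, ∀ U, l ≫ (stalkCone y).π.app U = s.π.app U := by
    obtain ⟨l, hl⟩ := exists_comp_fromSpecStalk s.pt.hom y (key s)
    refine ⟨Over.homMk l hl, fun U ↦ ?_⟩
    ext1
    refine (cancel_mono U.1.ι).1 ?_
    change (l ≫ U.1.fromSpecStalkOfMem y U.2.2) ≫ U.1.ι = _
    rw [Category.assoc, Scheme.Opens.fromSpecStalkOfMem_ι, hl]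
    exact (Over.w (s.π.app U)).symm
  { lift s := (lift s).choose
    fac s := (lift s).choose_spec
    uniq s m _ := by
      ext1
      refine (cancel_mono (Y.fromSpecStalk y)).1 ?_
      exact (Over.w m).trans (Over.w (lift s).choose).symm }

end FactorStalk

/-! ### Base change and disjoint gluing of trivial affine bundles. -/

section TrivialBundle

theorem isTrivialAffineBundle_iff {n : ℕ} {E X : Scheme.{u}} {p : E ⟶ X} :
    IsTrivialAffineBundle n p ↔
      ∃ e : E ≅ 𝔸(ULift.{u} (Fin n); X), e.hom ≫ 𝔸(ULift.{u} (Fin n); X) ↘ X = p :=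
  ⟨fun ⟨e⟩ ↦ ⟨(Over.forget X).mapIso e, Over.w e.hom⟩, fun ⟨e, he⟩ ↦ ⟨Over.isoMk e he⟩⟩

theorem isTrivialAffineBundle_affineSpace (n : ℕ) (X : Scheme.{u}) :
    IsTrivialAffineBundle n (𝔸(ULift.{u} (Fin n); X) ↘ X) := ⟨Iso.refl _⟩

theorem IsTrivialAffineBundle.of_isPullback {n : ℕ} {E E' X X' : Scheme.{u}} {p : E ⟶ X}
    {p' : E' ⟶ X'} {g' : E' ⟶ E} {g : X' ⟶ X} (hp : IsTrivialAffineBundle n p)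
    (h : IsPullback g' p' p g) : IsTrivialAffineBundle n p' := by
  obtain ⟨e, he⟩ := isTrivialAffineBundle_iff.1 hp
  have h' : IsPullback (g' ≫ e.hom) p' (𝔸(ULift.{u} (Fin n); X) ↘ X) g :=
    h.of_iso (Iso.refl _) e (Iso.refl _) (Iso.refl _) (by simp) (by simp) (by simp [he]) (by simp)
  have h2 := AffineSpace.isPullback_map (n := ULift.{u} (Fin n)) g
  exact isTrivialAffineBundle_iff.2 ⟨h'.isoIsPullback _ _ h2, by simp⟩

theorem IsTrivialAffineBundle.iso_comp {n : ℕ} {E E' X : Scheme.{u}} {p : E ⟶ X}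
    (hp : IsTrivialAffineBundle n p) (e : E' ≅ E) : IsTrivialAffineBundle n (e.hom ≫ p) :=
  hp.of_isPullback (g' := e.hom) (g := 𝟙 X) (IsPullback.of_horiz_isIso ⟨by simp⟩)

theorem IsTrivialAffineBundle.isAffineHom {n : ℕ} {E X : Scheme.{u}} {p : E ⟶ X}
    (hp : IsTrivialAffineBundle n p) : IsAffineHom p := by
  obtain ⟨e, rfl⟩ := isTrivialAffineBundle_iff.1 hp
  infer_instance

theorem isPullback_morphismRestrict_homOfLE {E X : Scheme.{u}} (p : E ⟶ X) {U V : X.Opens}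
    (h : U ≤ V) : IsPullback (E.homOfLE (p.preimage_mono h)) (p ∣_ U) (p ∣_ V) (X.homOfLE h) := by
  refine IsPullback.of_right (h₁₂ := (p ⁻¹ᵁ V).ι) (h₂₂ := V.ι) (v₁₃ := p) ?_ ?_
    (isPullback_morphismRestrict p V).flip
  · simpa using (isPullback_morphismRestrict p U).flip
  · rw [← cancel_mono V.ι]; simp

theorem IsTrivialAffineBundle.morphismRestrict_mono {n : ℕ} {E X : Scheme.{u}} {p : E ⟶ X}
    {U V : X.Opens} (hV : IsTrivialAffineBundle n (p ∣_ V)) (h : U ≤ V) :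
    IsTrivialAffineBundle n (p ∣_ U) :=
  hV.of_isPullback (isPullback_morphismRestrict_homOfLE p h)

theorem nonempty_isColimit_pullback_of_isCompl {E S S₁ S₂ : Scheme.{u}} (p : E ⟶ S) (i₁ : S₁ ⟶ S)
    (i₂ : S₂ ⟶ S) [IsOpenImmersion i₁] [IsOpenImmersion i₂]
    (h : IsCompl i₁.opensRange i₂.opensRange) :
    Nonempty (IsColimit (BinaryCofan.mk (pullback.fst p i₁) (pullback.fst p i₂))) := by
  refine nonempty_isColimit_binaryCofanMk_of_isCompl _ _ ?_
  rw [Scheme.Hom.opensRange_pullbackFst, Scheme.Hom.opensRange_pullbackFst]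
  have h1 := h.inf_eq_bot
  have h2 := h.sup_eq_top
  refine IsCompl.of_eq ?_ ?_
  · rw [← Scheme.Hom.preimage_inf, h1]; rfl
  · rw [← Scheme.Hom.preimage_sup, h2]; rfl

/-- Both `E` and `𝔸ⁿ` over `S` are coproducts of their restrictions to the two clopen parts, so the
two trivialisations need no compatibility to be glued. -/
theorem IsTrivialAffineBundle.of_isCompl {n : ℕ} {E S S₁ S₂ : Scheme.{u}} {p : E ⟶ S} {i₁ : S₁ ⟶ S}
    {i₂ : S₂ ⟶ S} [IsOpenImmersion i₁] [IsOpenImmersion i₂]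
    (h : IsCompl i₁.opensRange i₂.opensRange) (h₁ : IsTrivialAffineBundle n (pullback.snd p i₁))
    (h₂ : IsTrivialAffineBundle n (pullback.snd p i₂)) : IsTrivialAffineBundle n p := by
  let q := 𝔸(ULift.{u} (Fin n); S) ↘ S
  obtain ⟨hE⟩ := nonempty_isColimit_pullback_of_isCompl p i₁ i₂ h
  obtain ⟨hA⟩ := nonempty_isColimit_pullback_of_isCompl q i₁ i₂ h
  have hq {T : Scheme.{u}} (i : T ⟶ S) (hp : IsTrivialAffineBundle n (pullback.snd p i)) :
      ∃ e : pullback p i ≅ pullback q i, e.hom ≫ pullback.snd q i = pullback.snd p i := by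
    have h0 : IsTrivialAffineBundle n (pullback.snd q i) :=
      (isTrivialAffineBundle_affineSpace n S).of_isPullback (.of_hasPullback _ _)
    obtain ⟨e₁⟩ := h0
    obtain ⟨e₂⟩ := hp
    exact ⟨(Over.forget _).mapIso (e₂ ≪≫ e₁.symm), Over.w (e₂ ≪≫ e₁.symm).hom⟩
  obtain ⟨e₁, he₁⟩ := hq i₁ h₁
  obtain ⟨e₂, he₂⟩ := hq i₂ h₂
  obtain ⟨e, c₁, c₂⟩ : ∃ e : E ≅ 𝔸(ULift.{u} (Fin n); S),
      pullback.fst p i₁ ≫ e.hom = e₁.hom ≫ pullback.fst q i₁ ∧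
        pullback.fst p i₂ ≫ e.hom = e₂.hom ≫ pullback.fst q i₂ :=
    ⟨hE.coconePointsIsoOfNatIso hA (mapPairIso e₁ e₂),
      hE.comp_coconePointsIsoOfNatIso_hom hA (mapPairIso e₁ e₂) ⟨.left⟩,
      hE.comp_coconePointsIsoOfNatIso_hom hA (mapPairIso e₁ e₂) ⟨.right⟩⟩
  refine isTrivialAffineBundle_iff.2 ⟨e, BinaryCofan.IsColimit.hom_ext hE ?_ ?_⟩
  · change pullback.fst p i₁ ≫ e.hom ≫ q = pullback.fst p i₁ ≫ p
    rw [reassoc_of% c₁, pullback.condition, reassoc_of% he₁, pullback.condition]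
  · change pullback.fst p i₂ ≫ e.hom ≫ q = pullback.fst p i₂ ≫ p
    rw [reassoc_of% c₂, pullback.condition, reassoc_of% he₂, pullback.condition]

theorem IsTrivialAffineBundle.morphismRestrict_sup {n : ℕ} {E X : Scheme.{u}} {p : E ⟶ X}
    {U V : X.Opens} (hU : IsTrivialAffineBundle n (p ∣_ U)) (hV : IsTrivialAffineBundle n (p ∣_ V))
    (h : Disjoint U V) : IsTrivialAffineBundle n (p ∣_ (U ⊔ V)) := by
  have key {W W' : X.Opens} (hW : IsTrivialAffineBundle n (p ∣_ W)) (hle : W ≤ W') :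
      IsTrivialAffineBundle n (pullback.snd (p ∣_ W') (X.homOfLE hle)) := by
    have h1 := hW.iso_comp (isPullback_morphismRestrict_homOfLE p hle).isoPullback.symm
    simpa using h1
  refine IsTrivialAffineBundle.of_isCompl ?_ (key hU le_sup_left) (key hV le_sup_right)
  rw [Scheme.opensRange_homOfLE, Scheme.opensRange_homOfLE]
  refine IsCompl.of_eq ?_ ?_
  · rw [← Scheme.Hom.preimage_inf, h.eq_bot]; rfl
  · rw [← Scheme.Hom.preimage_sup, Scheme.Opens.ι_preimage_self]

end TrivialBundle

/-! ### Spreading out a trivialisation from a generic point. -/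

section Spread

/-- If the base change of `f` to `Spec 𝒪_{Y, y}` is a trivial affine bundle, then so is the
restriction of `f` to a neighbourhood of `y`. -/
theorem exists_isTrivialAffineBundle_morphismRestrict {X Y : Scheme.{u}} [IsLocallyNoetherian Y]
    (f : X ⟶ Y) [LocallyOfFiniteType f] [QuasiCompact f] [QuasiSeparated f] (y : Y) (n : ℕ)
    (h : IsTrivialAffineBundle n (pullback.snd f (Y.fromSpecStalk y))) :
    ∃ U : Y.Opens, y ∈ U ∧ IsTrivialAffineBundle n (f ∣_ U) := by
  let A : Over Y := Over.mk (𝔸(ULift.{u} (Fin n); Y) ↘ Y)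
  let B : Over Y := Over.mk f
  have hfp : LocallyOfFinitePresentation f :=
    LocallyOfFinitePresentation.iff_locallyOfFiniteType.mpr ‹_›
  have hB : LocallyOfFinitePresentation B.hom := hfp
  have hA : LocallyOfFinitePresentation A.hom :=
    inferInstanceAs (LocallyOfFinitePresentation (𝔸(ULift.{u} (Fin n); Y) ↘ Y))
  -- The transition maps are base changes of maps between affine schemes. With compactness and
  -- quasi-separatedness of each stage, this is what lets maps into a finitely presented scheme
  -- descend.
  have haff (Z : Over Y) {i j : AffineNhds y} (g : i ⟶ j) :
      IsAffineHom ((affineNhdsDiagram y ⋙ tensorLeft Z).map g).left := by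
    have : IsAffine i.1 := i.2.1
    have : IsAffine j.1 := j.2.1
    have h1 : IsPullback (pullback.fst Z.hom i.1.ι) (pullback.snd _ _) Z.hom i.1.ι :=
      .of_hasPullback _ _
    have h2 : IsPullback (pullback.fst Z.hom j.1.ι) (pullback.snd _ _) Z.hom j.1.ι :=
      .of_hasPullback _ _
    have h3 : IsPullback (Z ◁ (affineNhdsDiagram y).map g).left (pullback.snd Z.hom i.1.ι)
        (pullback.snd Z.hom j.1.ι) (Y.homOfLE (leOfHom g)) := by
      refine IsPullback.of_right (h₁₂ := pullback.fst Z.hom j.1.ι) (h₂₂ := j.1.ι) (v₁₃ := Z.hom)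
        ?_ (Over.whiskerLeft_left_snd (R := Z) ((affineNhdsDiagram y).map g)) h2
      have e1 : (Z ◁ (affineNhdsDiagram y).map g).left ≫ pullback.fst Z.hom j.1.ι =
          pullback.fst Z.hom i.1.ι := Over.whiskerLeft_left_fst (R := Z) ((affineNhdsDiagram y).map g)
      rw [Scheme.homOfLE_ι]
      exact e1 ▸ h1
    exact MorphismProperty.of_isPullback h3.flip inferInstance
  have hc (Z : Over Y) [QuasiCompact Z.hom] (i : AffineNhds y) :
      CompactSpace ((affineNhdsDiagram y ⋙ tensorLeft Z).obj i).left := by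
    change CompactSpace (pullback Z.hom i.1.ι :)
    have : CompactSpace i.1 := isCompact_iff_compactSpace.1 i.2.1.isCompact
    exact QuasiCompact.compactSpace_of_compactSpace (pullback.snd Z.hom i.1.ι)
  have hq (Z : Over Y) [QuasiSeparated Z.hom] (i : AffineNhds y) :
      QuasiSeparatedSpace ((affineNhdsDiagram y ⋙ tensorLeft Z).obj i).left := by
    change QuasiSeparatedSpace (pullback Z.hom i.1.ι :)
    have : IsAffine i.1 := i.2.1
    exact quasiSeparatedSpace_of_quasiSeparated (pullback.snd Z.hom i.1.ι)
  have : QuasiCompact A.hom := inferInstanceAs (QuasiCompact (𝔸(ULift.{u} (Fin n); Y) ↘ Y))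
  have : QuasiSeparated A.hom := inferInstanceAs (QuasiSeparated (𝔸(ULift.{u} (Fin n); Y) ↘ Y))
  have : QuasiCompact B.hom := ‹QuasiCompact f›
  have : QuasiSeparated B.hom := ‹QuasiSeparated f›
  have (Z Z' : Over Y) [QuasiCompact Z.hom] [QuasiSeparated Z.hom]
      [LocallyOfFinitePresentation Z'.hom] : PreservesColimit
      (affineNhdsDiagram y ⋙ tensorLeft Z).op (yoneda.obj Z') := by
    have : ∀ {i j : AffineNhds y} (g : i ⟶ j),
      IsAffineHom ((affineNhdsDiagram y ⋙ tensorLeft Z).map g).left := haff Z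
    have := hc Z
    have := hq Z
    exact Scheme.preservesColimit_yoneda (affineNhdsDiagram y ⋙ tensorLeft Z) Z'
  obtain ⟨e, he⟩ : ∃ e : B ⊗ (stalkCone y).pt ≅ A ⊗ (stalkCone y).pt,
      e.hom ≫ snd _ _ = snd _ _ := by
    have h0 : IsTrivialAffineBundle n (pullback.snd A.hom (Y.fromSpecStalk y)) :=
      (isTrivialAffineBundle_affineSpace n Y).of_isPullback (.of_hasPullback _ _)
    obtain ⟨e₁⟩ := h0
    obtain ⟨e₂⟩ := h
    let e := e₂ ≪≫ e₁.symm
    refine ⟨Over.isoMk ((Over.forget _).mapIso e) ?_, ?_⟩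
    · have h1 : e.hom.left ≫ pullback.snd A.hom (Y.fromSpecStalk y) =
        pullback.snd f (Y.fromSpecStalk y) := Over.w e.hom
      change e.hom.left ≫ pullback.fst A.hom (Y.fromSpecStalk y) ≫ A.hom =
        pullback.fst f (Y.fromSpecStalk y) ≫ f
      rw [pullback.condition, reassoc_of% h1, pullback.condition]
    · ext1
      exact Over.w e.hom
  obtain ⟨i, e', he'⟩ := exists_iso_of_isLimit (isLimitStalkCone y) B A e he
  refine ⟨i.1, i.2.2, ?_⟩
  have h1 : IsTrivialAffineBundle n (pullback.snd A.hom i.1.ι) :=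
    (isTrivialAffineBundle_affineSpace n Y).of_isPullback (.of_hasPullback _ _)
  have h2 := h1.iso_comp ((Over.forget _).mapIso e')
  have h3 : IsTrivialAffineBundle n (pullback.snd f i.1.ι) := by
    have h4 : e'.hom.left ≫ pullback.snd A.hom i.1.ι = pullback.snd f i.1.ι := congr($(he').left)
    exact h4 ▸ h2
  exact h3.of_isPullback (g' := (pullbackRestrictIsoRestrict f i.1).inv) (g := 𝟙 _)
    (IsPullback.of_horiz_isIso ⟨by rw [Category.comp_id]; rfl⟩)

theorem closure_singleton_mem_irreducibleComponents {Y : Type*} [TopologicalSpace Y] [QuasiSober Y]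
    {y : Y} (hy : ∀ z, z ⤳ y → z = y) : closure {y} ∈ irreducibleComponents Y := by
  refine ⟨isIrreducible_singleton.closure, fun T hT hle ↦ ?_⟩
  obtain ⟨t, ht⟩ := QuasiSober.sober hT.closure isClosed_closure
  have h1 : t ⤳ y := ht.specializes (subset_closure (hle (subset_closure rfl)))
  rw [← hy t h1]
  exact subset_closure.trans ht.symm.subset

theorem isField_stalk_of_forall_specializes {Y : Scheme.{u}} [IsReduced Y] (y : Y)
    (hy : ∀ z, z ⤳ y → z = y) : IsField (Y.presheaf.stalk y) :=
  isField_stalk_of_closure_mem_irreducibleComponents _ y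
    (closure_singleton_mem_irreducibleComponents hy)

/-- Over a neighbourhood of a generic point of a reduced locally noetherian scheme, a morphism of
finite type whose fibre is an affine space is a trivial affine bundle. -/
theorem exists_isTrivialAffineBundle_morphismRestrict_of_fiber {X Y : Scheme.{u}}
    [IsLocallyNoetherian Y] [IsReduced Y]
    (f : X ⟶ Y) [LocallyOfFiniteType f] [QuasiCompact f] [QuasiSeparated f] (y : Y) (n : ℕ)
    (hy : ∀ z, z ⤳ y → z = y)
    (h : IsTrivialAffineBundle n (f.fiberToSpecResidueField y)) :
    ∃ U : Y.Opens, y ∈ U ∧ IsTrivialAffineBundle n (f ∣_ U) := by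
  refine exists_isTrivialAffineBundle_morphismRestrict f y n ?_
  have hF := isField_stalk_of_forall_specializes y hy
  -- Since the stalk is a field, the fibre and the base change to the stalk coincide.
  have : IsIso (Y.residue y) := by
    let := hF.toField
    rw [ConcreteCategory.isIso_iff_bijective]
    exact ⟨(Y.residue y).hom.injective, Y.residue_surjective y⟩
  have hc : inv (Spec.map (Y.residue y)) ≫ Y.fromSpecResidueField y = Y.fromSpecStalk y := by
    rw [IsIso.inv_comp_eq]; rfl
  have h1 : IsPullback (pullback.fst f (Y.fromSpecStalk y)) (pullback.snd _ _) f
    (inv (Spec.map (Y.residue y)) ≫ Y.fromSpecResidueField y) := hc ▸ .of_hasPullback _ _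
  have h2 : IsPullback (pullback.fst f (Y.fromSpecResidueField y)) (pullback.snd _ _) f
    (Y.fromSpecResidueField y) := .of_hasPullback _ _
  have h3 := IsPullback.of_right' h1 h2
  exact h.of_isPullback h3

end Spread

/-! ### Generic points under a map with finite fibres. -/

section Topology

open TopologicalSpace

/-- The points without proper generizations, i.e. the generic points of the irreducible
components. -/
def maximalPoints (Y : Type*) [TopologicalSpace Y] : Set Y := {y | ∀ z, z ⤳ y → z = y}

theorem exists_mem_maximalPoints_specializes {Y : Type*} [TopologicalSpace Y] [QuasiSober Y]
    [T0Space Y] (y : Y) : ∃ z ∈ maximalPoints Y, z ⤳ y := by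
  obtain ⟨z, hz⟩ := QuasiSober.sober (isIrreducible_irreducibleComponent (x := y))
    isClosed_irreducibleComponent
  refine ⟨z, fun w hw ↦ ?_, hz.specializes mem_irreducibleComponent⟩
  have h1 : irreducibleComponent y ⊆ closure {w} := by
    rw [← hz]
    exact closure_minimal (by simpa using hw.mem_closure) isClosed_closure
  have h2 := eq_irreducibleComponent isIrreducible_singleton.closure.isPreirreducible h1
  have h3 : w ∈ irreducibleComponent y := h2 ▸ subset_closure rfl
  exact (hw.antisymm (hz.specializes h3)).eq

theorem finite_maximalPoints (Y : Type*) [TopologicalSpace Y] [NoetherianSpace Y] [QuasiSober Y]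
    [T0Space Y] : (maximalPoints Y).Finite := by
  refine Set.Finite.of_finite_image (f := fun y ↦ closure {y})
    ((NoetherianSpace.finite_irreducibleComponents (α := Y)).subset ?_) fun x _ y _ h ↦ ?_
  · rintro _ ⟨y, hy, rfl⟩
    exact closure_singleton_mem_irreducibleComponents hy
  · exact (inseparable_iff_closure_eq.2 h).eq

/-- Passes from neighbourhoods of generic points to a saturated open set. Here `P` stands for
triviality of `f` over an open set. No Noetherian hypothesis is made on `Q`; the closed set removed
from it is a finite union of closures of images of irreducible closed sets of `Y`. -/
theorem exists_opens_preimage_of_finite_fiber {Y Q : Type*} [TopologicalSpace Y]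
    [TopologicalSpace Q] [NoetherianSpace Y] [QuasiSober Y] [T0Space Y] [T0Space Q] [Nonempty Y]
    (φ : Y → Q) (hφ : Continuous φ) (hfin : ∀ q, (φ ⁻¹' {q}).Finite)
    (hdisc : ∀ y z, φ y = φ z → y ⤳ z → y = z) (P : Opens Y → Prop) (hbot : P ⊥)
    (hmono : ∀ U V, U ≤ V → P V → P U) (hsup : ∀ U V, Disjoint U V → P U → P V → P (U ⊔ V))
    (hgen : ∀ y ∈ maximalPoints Y, ∃ U : Opens Y, y ∈ U ∧ P U) :
    ∃ W : Opens Q, P (W.comap ⟨φ, hφ⟩) ∧ ∃ y, φ y ∈ W := by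
  classical
  have hS := finite_maximalPoints Y
  obtain ⟨ξ₀, hξ₀, -⟩ := exists_mem_maximalPoints_specializes (Classical.arbitrary Y)
  -- Maximality makes `φ ξ` the only point of the image of `φ` that specializes to `φ ξ`, which is
  -- `hq`. Discreteness of the fibre then makes all its points generic, which is `hF`.
  obtain ⟨ξ, hξ, hmax⟩ := hS.exists_maximalFor (fun y ↦ closure {φ y}) _ ⟨ξ₀, hξ₀⟩
  have hq (y : Y) (hy : φ y ⤳ φ ξ) : φ y = φ ξ := by
    obtain ⟨z, hz, hzy⟩ := exists_mem_maximalPoints_specializes y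
    have h1 : φ z ⤳ φ ξ := (hzy.map hφ).trans hy
    have h2 : φ ξ ⤳ φ z := specializes_iff_closure_subset.2
      (hmax hz (specializes_iff_closure_subset.1 h1))
    exact (hy.antisymm (h2.trans (hzy.map hφ))).eq
  have hF (y : Y) (hy : φ y = φ ξ) : y ∈ maximalPoints Y := fun z hz ↦
    hdisc _ _ ((hq z (hy ▸ hz.map hφ)).trans hy.symm) hz
  -- Removing the closures of the other generic points makes these neighbourhoods pairwise disjoint,
  -- as every point has a generic generization.
  have hV (y : Y) : ∃ V : Opens Y, y ∈ maximalPoints Y →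
      (y ∈ V ∧ P V ∧ ∀ x ∈ V, ∀ z ∈ maximalPoints Y, z ⤳ x → z = y) := by
    by_cases hy : y ∈ maximalPoints Y
    · obtain ⟨U, hyU, hU⟩ := hgen y hy
      have hc : IsClosed (⋃ z ∈ maximalPoints Y \ {y}, closure {z}) :=
        (hS.subset Set.sdiff_subset).isClosed_biUnion fun _ _ ↦ isClosed_closure
      refine ⟨U ⊓ ⟨_, hc.isOpen_compl⟩, fun _ ↦ ⟨⟨hyU, ?_⟩, hmono _ _ inf_le_left hU, ?_⟩⟩
      · intro h
        obtain ⟨z, hz, hzy⟩ := Set.mem_iUnion₂.1 h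
        exact hz.2 (hy z (specializes_iff_mem_closure.2 hzy))
      · intro x hx z hz hzx
        by_contra hne
        exact hx.2 (Set.mem_biUnion (⟨hz, hne⟩ : z ∈ maximalPoints Y \ {y})
          (specializes_iff_mem_closure.1 hzx))
    · exact ⟨⊥, fun h ↦ (hy h).elim⟩
  choose V hV using hV
  have hP (F : Finset Y) (hF : ∀ y ∈ F, y ∈ maximalPoints Y) : P (F.sup V) := by
    induction F using Finset.induction_on with
    | empty => simpa using hbot
    | insert a F ha ih =>
      rw [Finset.sup_insert]
      have haS := hF a (by simp)
      have hFS (y) (hy : y ∈ F) := hF y (by simp [hy])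
      refine hsup _ _ ?_ (hV a haS).2.1 (ih hFS)
      rw [Finset.disjoint_sup_right]
      intro b hb
      rw [disjoint_iff_inf_le]
      intro x hx
      obtain ⟨z, hz, hzx⟩ := exists_mem_maximalPoints_specializes x
      have h1 := (hV a haS).2.2 x hx.1 z hz hzx
      have h2 := (hV b (hFS b hb)).2.2 x hx.2 z hz hzx
      exact (ha (by rwa [← h1, h2])).elim
  let U := (hfin (φ ξ)).toFinset.sup V
  have hU : P U := hP _ fun y hy ↦ hF y (by simpa using hy)
  have hFU (y : Y) (hy : φ y = φ ξ) : y ∈ U :=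
    (Finset.le_sup (f := V) (by simpa using hy) : V y ≤ U) (hV y (hF y hy)).1
  -- If `φ ξ` lay in the closure of the image of an irreducible piece `t` of the complement of `U`,
  -- the generic point of `t` would map to a generization of `φ ξ`. By `hq` it would lie in the
  -- fibre, hence in `U`.
  obtain ⟨S, hSfin, hScl, hSirr, hSU⟩ :=
    NoetherianSpace.exists_finite_set_isClosed_irreducible U.isOpen.isClosed_compl
  have hSU' (t) (ht : t ∈ S) (x) (hx : x ∈ t) : x ∉ U :=
    (hSU ▸ Set.mem_sUnion_of_mem hx ht : x ∈ (U : Set Y)ᶜ)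
  have hc : IsClosed (⋃ t ∈ S, closure (φ '' t)) :=
    hSfin.isClosed_biUnion fun _ _ ↦ isClosed_closure
  refine ⟨⟨_, hc.isOpen_compl⟩, hmono _ U ?_ hU, ξ, ?_⟩
  · intro x hx
    by_contra hxU
    obtain ⟨t, ht, hxt⟩ : x ∈ ⋃₀ S := hSU ▸ hxU
    exact hx (Set.mem_biUnion ht (subset_closure ⟨x, hxt, rfl⟩))
  · intro h
    obtain ⟨t, ht, hξt⟩ := Set.mem_iUnion₂.1 h
    obtain ⟨z, hz⟩ := QuasiSober.sober (hSirr t ht) (hScl t ht)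
    have h1 : φ '' t ⊆ closure {φ z} := by
      rw [← hz]
      exact (image_closure_subset_closure_image hφ).trans (by simp)
    have h2 : φ z ⤳ φ ξ :=
      specializes_iff_mem_closure.2 (closure_minimal h1 isClosed_closure hξt)
    exact hSU' t ht z (hz ▸ subset_closure rfl) (hFU z (hq z h2))

end Topology

/-! ### Actions restricted to subobjects. -/

section ModMono

variable {C : Type*} [Category C] [CartesianMonoidalCategory C] {G : C} [MonObj G]

/-- The action on a subobject which is preserved by the action on the ambient object. -/
@[reducible] def modObjOfMono {Z X : C} [ModObj G X] (i : Z ⟶ X) [Mono i] (a : G ⊗ Z ⟶ Z)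
    (h : a ≫ i = G ◁ i ≫ γ[G, X]) : ModObj G Z where
  smul := a
  one_smul := by
    change η ▷ Z ≫ a = (λ_ Z).hom
    rw [← cancel_mono i, Category.assoc, h, ← whisker_exchange_assoc, ModObj.one_smul_self,
      leftUnitor_naturality]
  mul_smul := by
    change μ ▷ Z ≫ a = (α_ _ _ Z).hom ≫ G ◁ a ≫ a
    rw [← cancel_mono i]
    simp only [Category.assoc, h, ← whisker_exchange_assoc, ModObj.mul_smul_self,
      ← MonoidalCategory.whiskerLeft_comp_assoc]
    simp

theorem isModHom_of_mono {Z X : C} [ModObj G X] (i : Z ⟶ X) [Mono i] (a : G ⊗ Z ⟶ Z)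
    (h : a ≫ i = G ◁ i ≫ γ[G, X]) :
    @IsModHom _ _ _ _ _ _ G _ _ _ (modObjOfMono i a h) _ i :=
  let := modObjOfMono i a h
  ⟨h⟩

theorem isModHom_of_comp_mono {W Z X : C} [ModObj G W] [ModObj G Z] [ModObj G X] (g : W ⟶ Z)
    (i : Z ⟶ X) [Mono i] (hi : IsModHom G i) (h : IsModHom G (g ≫ i)) : IsModHom G g := by
  refine ⟨(cancel_mono i).1 ?_⟩
  have h1 : γ[G, Z] ≫ i = G ◁ i ≫ γ[G, X] := hi.smul_hom
  have h2 : γ[G, W] ≫ g ≫ i = G ◁ (g ≫ i) ≫ γ[G, X] := h.smul_hom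
  change (γ[G, W] ≫ g) ≫ i = (G ◁ g ≫ γ[G, Z]) ≫ i
  simp [h1, h2]

end ModMono

/-! ### Reduced closed subschemes and factorization through them. -/

section Reduced

open TopologicalSpace

theorem exists_isReduced_isClosedImmersion {X : Scheme.{u}} (S : Closeds X) :
    ∃ (Z : Scheme.{u}) (i : Z ⟶ X), IsReduced Z ∧ IsClosedImmersion i ∧ Set.range i = S := by
  let I := Scheme.IdealSheafData.vanishingIdeal S
  refine ⟨I.subscheme, I.subschemeι, ?_, inferInstance, ?_⟩
  · have h (V : X.affineOpens) : _root_.IsReduced (Γ(X, V.1) ⧸ I.ideal V) := by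
      rw [← Ideal.isRadical_iff_quotient_reduced]
      exact PrimeSpectrum.isRadical_vanishingIdeal _
    have (V : X.affineOpens) : IsReduced (I.subschemeCover.openCover.X V) :=
      have := h V
      inferInstanceAs (IsReduced (Spec (.of (Γ(X, V.1) ⧸ I.ideal V))))
    exact @IsReduced.of_openCover _ I.subschemeCover.openCover this
  · rw [Scheme.IdealSheafData.range_subschemeι, Scheme.IdealSheafData.coe_support_vanishingIdeal]

/-- As `T` is reduced, the kernel of `g` is the full vanishing ideal of its image, so the inclusion
of ideals needed for the factorization is a set-theoretic condition. -/
theorem exists_lift_of_isReduced {T Z X : Scheme.{u}} [IsReduced T] (i : Z ⟶ X)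
    [IsClosedImmersion i] (g : T ⟶ X) (h : Set.range g ⊆ Set.range i) : ∃ l, l ≫ i = g := by
  refine ⟨IsClosedImmersion.lift i g ?_, IsClosedImmersion.lift_fac _ _ _⟩
  have h1 : (⊥ : T.IdealSheafData) = Scheme.IdealSheafData.vanishingIdeal ⊤ := by
    rw [Scheme.IdealSheafData.vanishingIdeal_top, Scheme.nilradical_eq_bot]
  rw [← Scheme.IdealSheafData.map_bot g, h1, Scheme.IdealSheafData.map_vanishingIdeal,
    ← Scheme.IdealSheafData.le_support_iff_le_vanishingIdeal, Closeds.closure_le]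
  rintro _ ⟨t, -, rfl⟩
  exact i.range_subset_ker_support (h ⟨t, rfl⟩)

end Reduced

/-! ### Prime avoidance for finite sets of points. -/

section FiniteInAffine

theorem exists_basicOpen_le_of_finite {R : Type*} [CommRing R] {S : Set (PrimeSpectrum R)}
    (hS : S.Finite) {O : Set (PrimeSpectrum R)} (hO : IsOpen O) (hSO : S ⊆ O) :
    ∃ r : R, S ⊆ PrimeSpectrum.basicOpen r ∧ (PrimeSpectrum.basicOpen r : Set _) ⊆ O := by
  obtain ⟨I, hI⟩ := (PrimeSpectrum.isClosed_iff_zeroLocus_ideal _).1 hO.isClosed_compl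
  have h1 : ¬ ((I : Set R) ⊆ ⋃ J ∈ PrimeSpectrum.asIdeal '' S, (J : Set R)) := by
    refine fun hsub ↦ ?_
    obtain ⟨_, ⟨p, hp, rfl⟩, hle⟩ := (Ideal.subset_union_prime_finite (hS.image _) (f := id) ⊥ ⊥
      (by rintro _ ⟨p, -, rfl⟩ _ _; exact p.isPrime)).1 hsub
    exact (hI ▸ (hle : p ∈ PrimeSpectrum.zeroLocus I) : p ∈ Oᶜ) (hSO hp)
  obtain ⟨r, hrI, hr⟩ := Set.not_subset.1 h1
  refine ⟨r, fun p hp hrp ↦ hr (Set.mem_biUnion ⟨p, hp, rfl⟩ hrp), fun p hp ↦ ?_⟩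
  by_contra hpO
  have h2 : p ∈ PrimeSpectrum.zeroLocus I := hI ▸ (hpO : p ∈ Oᶜ)
  exact hp (h2 hrI)

/-- A finite set of points contained in an affine open subset is contained in an affine open subset
of any of its open neighbourhoods. -/
theorem exists_isAffineOpen_of_finite {X : Scheme.{u}} {V O : X.Opens} (hV : IsAffineOpen V)
    {S : Set X} (hS : S.Finite) (hSV : S ⊆ V) (hSO : S ⊆ O) :
    ∃ U : X.Opens, IsAffineOpen U ∧ S ⊆ U ∧ U ≤ O := by
  obtain ⟨r, hr, hrO⟩ := exists_basicOpen_le_of_finite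
    (S := hV.fromSpec ⁻¹' S) (hS.preimage hV.fromSpec.isOpenEmbedding.injective.injOn)
    (O := hV.fromSpec ⁻¹' O) (O.isOpen.preimage hV.fromSpec.continuous) (Set.preimage_mono hSO)
  have hpre := hV.fromSpec_preimage_basicOpen r
  refine ⟨X.basicOpen r, hV.basicOpen r, fun x hx ↦ ?_, fun x hx ↦ ?_⟩
  · obtain ⟨p, rfl⟩ : x ∈ Set.range hV.fromSpec := hV.range_fromSpec ▸ hSV hx
    have : p ∈ hV.fromSpec ⁻¹ᵁ X.basicOpen r := hpre ▸ hr hx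
    exact this
  · obtain ⟨p, rfl⟩ : x ∈ Set.range hV.fromSpec := hV.range_fromSpec ▸ X.basicOpen_le r hx
    have : p ∈ PrimeSpectrum.basicOpen r := hpre ▸ (hx : p ∈ hV.fromSpec ⁻¹ᵁ X.basicOpen r)
    exact hrO this

end FiniteInAffine

/-! ### Invariant subvarieties and goodness of restricted actions. -/

section Actions

variable {k : Type u} [Field k] {G : Over (Spec (.of k))} [GrpObj G]

theorem map_mem_orbit {X Y : Over (Spec (.of k))} [ModObj G X] [ModObj G Y] {f : X ⟶ Y}
    (hf : IsModHom G f) {x x' : X.left} (h : x' ∈ orbit G x) :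
    f.left x' ∈ orbit G (f.left x) := by
  obtain ⟨z, hz, rfl⟩ := h
  have hz' : (snd G X).left z = x := hz
  have h1 : γ[G, X] ≫ f = G ◁ f ≫ γ[G, Y] := hf.smul_hom
  refine ⟨(G ◁ f).left z, ?_, ?_⟩
  · rw [Set.mem_preimage, Set.mem_singleton_iff, ← hz', ← Scheme.Hom.comp_apply,
      ← Scheme.Hom.comp_apply, ← Over.comp_left, ← Over.comp_left, whiskerLeft_snd]
  · rw [← Scheme.Hom.comp_apply, ← Scheme.Hom.comp_apply, ← Over.comp_left, ← Over.comp_left, h1]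

theorem IsGoodAction.of_isAffineHom {X Y : Over (Spec (.of k))} [ModObj G X] [ModObj G Y]
    {f : X ⟶ Y} (hf : IsModHom G f) [IsAffineHom f.left] (hY : IsGoodAction G Y) :
    IsGoodAction G X := fun x ↦ by
  obtain ⟨U, hU, hxU⟩ := hY (f.left x)
  exact ⟨f.left ⁻¹ᵁ U, hU.preimage f.left, fun _ h ↦ hxU (map_mem_orbit hf h)⟩

theorem orbit_subset_preimage {X Q : Over (Spec (.of k))} [ModObj G X] {h : X ⟶ Q}
    (hinv : γ[G, X] ≫ h = snd G X ≫ h) (x : X.left) :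
    orbit G x ⊆ h.left ⁻¹' {h.left x} := by
  rintro _ ⟨z, hz, rfl⟩
  have hz' : (snd G X).left z = x := hz
  rw [Set.mem_preimage, Set.mem_singleton_iff, ← hz', ← Scheme.Hom.comp_apply,
    ← Scheme.Hom.comp_apply, ← Over.comp_left, ← Over.comp_left, hinv]

/-- An affine open containing the orbit in `Y` need not lie in `U`. Finiteness of orbits allows it
to be shrunk into `U` by prime avoidance. -/
theorem IsGoodAction.of_isOpenImmersion {U Y : Over (Spec (.of k))} [ModObj G U] [ModObj G Y]
    {j : U ⟶ Y} (hj : IsModHom G j) [IsOpenImmersion j.left] (hY : IsGoodAction G Y)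
    (hfin : ∀ y : Y.left, (orbit G y).Finite) : IsGoodAction G U := fun x ↦ by
  obtain ⟨V, hV, hxV⟩ := hY (j.left x)
  have h1 : j.left '' orbit G x ⊆ orbit G (j.left x) := by
    rintro _ ⟨x', hx', rfl⟩
    exact map_mem_orbit hj hx'
  obtain ⟨W, hW, hSW, hWU⟩ := exists_isAffineOpen_of_finite (O := j.left.opensRange) hV
    ((hfin (j.left x)).subset h1) (h1.trans hxV) (by rintro _ ⟨x', -, rfl⟩; exact ⟨x', rfl⟩)
  exact ⟨j.left ⁻¹ᵁ W, hW.preimage_of_isOpenImmersion _ hWU, fun x' hx' ↦ hSW ⟨x', hx', rfl⟩⟩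

theorem range_whiskerLeft_smul_subset {Z X Q : Over (Spec (.of k))} [ModObj G X] {h : X ⟶ Q}
    (hinv : γ[G, X] ≫ h = snd G X ≫ h) (i : Z ⟶ X) (S : Set Q.left)
    (hi : Set.range i.left = h.left ⁻¹' S) :
    Set.range (G ◁ i ≫ γ[G, X]).left ⊆ Set.range i.left := by
  rintro _ ⟨z, rfl⟩
  have h1 : (G ◁ i ≫ γ[G, X]) ≫ h = (snd G Z ≫ i) ≫ h := by
    rw [Category.assoc, hinv, whiskerLeft_snd_assoc, Category.assoc]
  have h2 : i.left ((snd G Z).left z) ∈ h.left ⁻¹' S := hi ▸ ⟨_, rfl⟩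
  rw [hi, Set.mem_preimage, ← Scheme.Hom.comp_apply, ← Over.comp_left, h1]
  rw [Set.mem_preimage, ← Scheme.Hom.comp_apply, ← Scheme.Hom.comp_apply, ← Over.comp_left,
    ← Over.comp_left] at h2
  exact h2

theorem mono_of_mono_left {S : Scheme.{u}} {Z X : Over S} (i : Z ⟶ X) [Mono i.left] : Mono i :=
  (Over.forget S).mono_of_mono_map ‹_›

theorem exists_modObj_of_lift {Z X : Over (Spec (.of k))} [ModObj G X] (i : Z ⟶ X) [Mono i.left]
    (h : ∃ l, l ≫ i.left = (G ◁ i ≫ γ[G, X]).left) : ∃ _ : ModObj G Z, IsModHom G i := by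
  obtain ⟨l, hl⟩ := h
  have := mono_of_mono_left i
  let a : G ⊗ Z ⟶ Z := Over.homMk l (by
    rw [← Over.w i, reassoc_of% hl]
    exact Over.w (G ◁ i ≫ γ[G, X]))
  have ha : a ≫ i = G ◁ i ≫ γ[G, X] := by
    ext1
    exact hl
  exact ⟨modObjOfMono i a ha, isModHom_of_mono i a ha⟩

/-- The restriction of an action to an open subscheme which is a preimage under an invariant
morphism. -/
theorem exists_modObj_of_isOpenImmersion {U X Q : Over (Spec (.of k))} [ModObj G X] {h : X ⟶ Q}
    (hinv : γ[G, X] ≫ h = snd G X ≫ h) (j : U ⟶ X) [IsOpenImmersion j.left] (S : Set Q.left)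
    (hj : Set.range j.left = h.left ⁻¹' S) : ∃ _ : ModObj G U, IsModHom G j :=
  exists_modObj_of_lift j ⟨IsOpenImmersion.lift j.left (G ◁ j ≫ γ[G, X]).left
    (range_whiskerLeft_smul_subset hinv j S hj), IsOpenImmersion.lift_fac _ _ _⟩

/-- The restriction of an action to a reduced closed subscheme which is a preimage under an invariant
morphism. -/
theorem exists_modObj_of_isClosedImmersion [CharZero k] [IsAlgebraicGroup G]
    {Z X Q : Over (Spec (.of k))} [ModObj G X] {h : X ⟶ Q}
    (hinv : γ[G, X] ≫ h = snd G X ≫ h) (hZ : IsVariety Z) (i : Z ⟶ X) [IsClosedImmersion i.left]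
    (S : Set Q.left) (hi : Set.range i.left = h.left ⁻¹' S) :
    ∃ _ : ModObj G Z, IsModHom G i := by
  -- Characteristic zero keeps `G × Z` reduced, so the action map factors through `Z` as soon as it
  -- does so on points.
  have : IsReduced (G ⊗ Z).left := ((IsAlgebraicGroup.isVariety (G := G)).prod hZ).isReduced
  exact exists_modObj_of_lift i
    (exists_lift_of_isReduced i.left _ (range_whiskerLeft_smul_subset hinv i S hi))

theorem IsVariety.isLocallyNoetherian {X : Over (Spec (.of k))} (hX : IsVariety X) :
    IsLocallyNoetherian X.left :=
  have := hX.locallyOfFiniteType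
  LocallyOfFiniteType.isLocallyNoetherian X.hom

theorem IsVariety.isNoetherian {X : Over (Spec (.of k))} (hX : IsVariety X) :
    IsNoetherian X.left :=
  have := hX.isLocallyNoetherian
  have := hX.quasiCompact
  have : CompactSpace X.left := QuasiCompact.compactSpace_of_compactSpace X.hom
  { }

theorem IsVariety.of_isOpenImmersion {U X : Over (Spec (.of k))} (hX : IsVariety X) (j : U ⟶ X)
    [IsOpenImmersion j.left] : IsVariety U := by
  have := hX.isLocallyNoetherian
  obtain ⟨_, _, _, _⟩ := hX
  refine ⟨isReduced_of_isOpenImmersion j.left, ?_, ?_, ?_⟩ <;>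
    (rw [← Over.w j]; infer_instance)

theorem IsVariety.of_isClosedImmersion {Z X : Over (Spec (.of k))} (hX : IsVariety X) (i : Z ⟶ X)
    [IsClosedImmersion i.left] (hZ : IsReduced Z.left) : IsVariety Z := by
  obtain ⟨_, _, _, _⟩ := hX
  refine ⟨hZ, ?_, ?_, ?_⟩ <;> (rw [← Over.w i]; infer_instance)

/-- The reduced closed subvariety of `X` which is the preimage of a closed set under an invariant
morphism. -/
theorem GVariety.exists_isClosedImmersion [CharZero k] [IsAlgebraicGroup G] (X : GVariety G)
    {Q : Over (Spec (.of k))} {h : X.obj ⟶ Q} (hinv : γ[G, X.obj] ≫ h = snd G X.obj ≫ h)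
    {S : Set Q.left} (hS : IsClosed S) :
    ∃ (Z : GVariety G) (i : Z.obj ⟶ X.obj), IsModHom G i ∧ IsClosedImmersion i.left ∧
      Set.range i.left = h.left ⁻¹' S := by
  obtain ⟨Z, i, _, _, hr⟩ :=
    exists_isReduced_isClosedImmersion ⟨h.left ⁻¹' S, hS.preimage h.left.continuous⟩
  let i' : Over.mk (i ≫ X.obj.hom) ⟶ X.obj := Over.homMk i
  have : IsClosedImmersion i'.left := ‹IsClosedImmersion i›
  have hZ : IsVariety (Over.mk (i ≫ X.obj.hom)) := X.isVariety.of_isClosedImmersion i' ‹_›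
  obtain ⟨act, hact⟩ := exists_modObj_of_isClosedImmersion hinv hZ i' S hr
  exact ⟨⟨_, hZ, IsGoodAction.of_isAffineHom hact X.good⟩, i', hact, this, hr⟩

end Actions

/-! ### Iterating affine lines. -/

section Iterate

theorem isTrivialAffineBundle_id (X : Scheme.{u}) : IsTrivialAffineBundle 0 (𝟙 X) :=
  have : IsEmpty (ULift.{u} (Fin 0)) := inferInstance
  isTrivialAffineBundle_iff.2 ⟨(asIso (𝔸(ULift.{u} (Fin 0); X) ↘ X)).symm, by simp⟩

/-- `𝔸¹` over `𝔸ⁿ` is `𝔸ⁿ⁺¹`. -/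
theorem isTrivialAffineBundle_succ_affineSpace (n : ℕ) (S : Scheme.{u}) :
    IsTrivialAffineBundle (n + 1)
      (𝔸(ULift.{u} (Fin 1); 𝔸(ULift.{u} (Fin n); S)) ↘ 𝔸(ULift.{u} (Fin n); S) ≫
        𝔸(ULift.{u} (Fin n); S) ↘ S) := by
  let p := 𝔸(ULift.{u} (Fin 1); 𝔸(ULift.{u} (Fin n); S)) ↘ 𝔸(ULift.{u} (Fin n); S)
  let q := 𝔸(ULift.{u} (Fin n); S) ↘ S
  -- The coordinate of the line over `𝔸ⁿ` becomes the last one; the first `n` are pulled back from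
  -- `𝔸ⁿ`.
  let v : ULift.{u} (Fin (n + 1)) → Γ(𝔸(ULift.{u} (Fin 1); 𝔸(ULift.{u} (Fin n); S)), ⊤) :=
    fun i ↦ Fin.lastCases (motive := fun _ ↦ _) (AffineSpace.coord _ ⟨0⟩)
      (fun j ↦ p.appTop (AffineSpace.coord S ⟨j⟩)) i.down
  let F := AffineSpace.homOfVector (p ≫ q) v
  let g := AffineSpace.homOfVector (𝔸(ULift.{u} (Fin (n + 1)); S) ↘ S)
    (fun j : ULift.{u} (Fin n) ↦ AffineSpace.coord S ⟨j.down.castSucc⟩)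
  let F' := AffineSpace.homOfVector g
    (fun _ : ULift.{u} (Fin 1) ↦ AffineSpace.coord S ⟨Fin.last n⟩)
  have hg : g ≫ q = 𝔸(ULift.{u} (Fin (n + 1)); S) ↘ S := AffineSpace.homOfVector_over _ _
  have hF (i) : F.appTop (AffineSpace.coord S i) = v i := AffineSpace.homOfVector_appTop_coord _ _ _
  have hF' (i) : F'.appTop (AffineSpace.coord _ i) = AffineSpace.coord S ⟨Fin.last n⟩ :=
    AffineSpace.homOfVector_appTop_coord _ _ _
  have hgc (i) : g.appTop (AffineSpace.coord S i) = AffineSpace.coord S ⟨i.down.castSucc⟩ :=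
    AffineSpace.homOfVector_appTop_coord _ _ _
  have hcomp {X Y Z : Scheme.{u}} (a : X ⟶ Y) (b : Y ⟶ Z) (s : Γ(Z, ⊤)) :
      (a ≫ b).appTop s = a.appTop (b.appTop s) := by
    rw [Scheme.Hom.comp_appTop, CommRingCat.comp_apply]
  have hid {X : Scheme.{u}} (s : Γ(X, ⊤)) : (𝟙 X : X ⟶ X).appTop s = s := by
    rw [Scheme.Hom.id_appTop, CommRingCat.id_apply]
  have hFg : F ≫ g = p := by
    refine AffineSpace.hom_ext ?_ fun j ↦ ?_
    · rw [Category.assoc, hg]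
      exact AffineSpace.homOfVector_over _ _
    · rw [hcomp, hgc, hF]
      exact Fin.lastCases_castSucc ..
  have hF'p : F' ≫ p = g := AffineSpace.homOfVector_over _ _
  refine isTrivialAffineBundle_iff.2 ⟨⟨F, F', ?_, ?_⟩, AffineSpace.homOfVector_over _ _⟩
  · refine AffineSpace.hom_ext ?_ fun j ↦ ?_
    · rw [Category.assoc, AffineSpace.homOfVector_over, hFg, Category.id_comp]
    · obtain ⟨j⟩ := j
      obtain rfl : j = 0 := Subsingleton.elim _ _
      rw [hcomp, hF', hF, hid]
      exact Fin.lastCases_last ..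
  · refine AffineSpace.hom_ext ?_ fun j ↦ ?_
    · rw [Category.assoc, AffineSpace.homOfVector_over, Category.id_comp, reassoc_of% hF'p, hg]
    · obtain ⟨j⟩ := j
      rw [hcomp, hF, hid]
      induction j using Fin.lastCases with
      | last =>
        have h : v ⟨Fin.last n⟩ = AffineSpace.coord _ ⟨0⟩ := Fin.lastCases_last ..
        rw [h, hF']
      | cast j =>
        have h : v ⟨j.castSucc⟩ = p.appTop (AffineSpace.coord S ⟨j⟩) := Fin.lastCases_castSucc ..
        rw [h, ← hcomp, hF'p, hgc]

theorem IsTrivialAffineBundle.comp_succ {n : ℕ} {E E' X : Scheme.{u}} {p : E ⟶ X} {q : E' ⟶ E}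
    (hq : IsTrivialAffineBundle 1 q) (hp : IsTrivialAffineBundle n p) :
    IsTrivialAffineBundle (n + 1) (q ≫ p) := by
  obtain ⟨e, rfl⟩ := isTrivialAffineBundle_iff.1 hp
  obtain ⟨e', he'⟩ := isTrivialAffineBundle_iff.1 (hq.of_isPullback (g := e.inv) (g' := 𝟙 E')
    (p' := q ≫ e.hom) (IsPullback.of_horiz_isIso ⟨by simp⟩))
  have := (isTrivialAffineBundle_succ_affineSpace n X).iso_comp e'
  rwa [reassoc_of% he'] at this

end Iterate

/-! ### Relations in the Grothendieck ring. -/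

section Ring

variable {k : Type u} [Field k] {G : Over (Spec (.of k))} [GrpObj G]

theorem isTrivialAffineBundle_fst_affineLine (X : GVariety G) :
    IsTrivialAffineBundle 1 (fst X.obj (GVariety.affineLine G).obj).left :=
  (isTrivialAffineBundle_affineSpace 1 (Spec (.of k))).of_isPullback
    (IsPullback.of_hasPullback X.obj.hom (GVariety.affineLine G).obj.hom).flip

variable [CharZero k]

theorem GVariety.cls_eq_add (X Z U : GVariety G) (i : Z.obj ⟶ X.obj) (j : U.obj ⟶ X.obj)
    (hi : IsModHom G i) (hj : IsModHom G j) (hi' : IsClosedImmersion i.left)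
    (hj' : IsOpenImmersion j.left) (h : Set.range j.left = (Set.range i.left)ᶜ) :
    X.cls = Z.cls + U.cls := by
  have h1 : X.free - Z.free - U.free ∈ Ideal.span (scissorRelators G ∪ affineRelators G) :=
    Ideal.subset_span (.inl ⟨X, Z, U, i, j, hi, hj, hi', hj', h, rfl⟩)
  have h2 := Ideal.Quotient.eq_zero_iff_mem.2 h1
  rw [map_sub, map_sub, sub_sub, sub_eq_zero] at h2
  exact h2

theorem GVariety.cls_eq_of_isTrivialAffineBundle {n : ℕ} {X E E' : GVariety G}
    {p : E.obj ⟶ X.obj} {p' : E'.obj ⟶ X.obj} (hp : IsModHom G p) (hp' : IsModHom G p')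
    (h : IsTrivialAffineBundle n p.left) (h' : IsTrivialAffineBundle n p'.left) :
    E.cls = E'.cls :=
  (Ideal.Quotient.eq).2 (Ideal.subset_span (.inr ⟨n, X, E, E', p, p', hp, hp', h, h', rfl⟩))

theorem GVariety.cls_prod (X Y : GVariety G) : (X.prod Y).cls = X.cls * Y.cls := by
  have h : (X.prod Y).free = X.free * Y.free :=
    map_mul (MonoidAlgebra.of ℤ (IsoClass G)) X.isoClass Y.isoClass
  exact (congrArg (Ideal.Quotient.mk _) h).trans (map_mul _ _ _)

theorem GVariety.cls_eq_zero (X : GVariety G) [IsEmpty X.obj.left] : X.cls = 0 := by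
  have h : IsModHom G (𝟙 X.obj) := inferInstance
  have h1 : IsClosedImmersion (𝟙 X.obj : X.obj ⟶ X.obj).left :=
    inferInstanceAs (IsClosedImmersion (𝟙 X.obj.left))
  have h2 : IsOpenImmersion (𝟙 X.obj : X.obj ⟶ X.obj).left :=
    inferInstanceAs (IsOpenImmersion (𝟙 X.obj.left))
  -- An empty `X` is both closed part and open complement of itself, giving `[X] = [X] + [X]`.
  have h3 := GVariety.cls_eq_add X X X (𝟙 _) (𝟙 _) h h h1 h2 (Subsingleton.elim _ _)
  simpa using h3

/-- Supplies the reference bundle: the product of `X` with `n` copies of the line with trivial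
action, to which the affine relators compare any other lift. -/
theorem GVariety.exists_isTrivialAffineBundle (X : GVariety G) (n : ℕ) :
    ∃ (E : GVariety G) (p : E.obj ⟶ X.obj), IsModHom G p ∧ IsTrivialAffineBundle n p.left ∧
      E.cls = X.cls * lefschetz G ^ n := by
  induction n with
  | zero =>
    exact ⟨X, 𝟙 _, inferInstance, isTrivialAffineBundle_id X.obj.left, by simp⟩
  | succ n ih =>
    obtain ⟨E, p, hp, hpt, hE⟩ := ih
    let E' := E.prod (affineLine G)
    let q : E'.obj ⟶ E.obj := fst E.obj (affineLine G).obj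
    have hq : IsModHom G q := isModHom_fst
    exact ⟨E', q ≫ p, inferInstance, (isTrivialAffineBundle_fst_affineLine E).comp_succ hpt,
      by rw [cls_prod, hE, pow_succ, ← _root_.mul_assoc]; rfl⟩

theorem GVariety.cls_eq_mul_lefschetz_pow {X E : GVariety G} {n : ℕ} {p : E.obj ⟶ X.obj}
    (hp : IsModHom G p) (h : IsTrivialAffineBundle n p.left) :
    E.cls = X.cls * lefschetz G ^ n := by
  obtain ⟨E', p', hp', h', hE'⟩ := X.exists_isTrivialAffineBundle n
  exact (cls_eq_of_isTrivialAffineBundle hp hp' h h').trans hE'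

end Ring

/-! ### Fibres over a closed subscheme. -/

section Fiber

/-- The fibres of a morphism with affine space fibres do not change when it is restricted to the
preimage of a closed subscheme, with any scheme structure. -/
theorem isTrivialAffineBundle_fiber_of_isClosedImmersion {X Y X' Z : Scheme.{u}} {n : ℕ}
    {f : X ⟶ Y} {f' : X' ⟶ Z} {i : Z ⟶ Y} {i' : X' ⟶ X} [IsClosedImmersion i]
    [IsClosedImmersion i'] (hc : i' ≫ f = f' ≫ i) (hr : f ⁻¹' Set.range i ⊆ Set.range i') (z : Z)
    (h : IsTrivialAffineBundle n (f.fiberToSpecResidueField (i z))) :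
    IsTrivialAffineBundle n (f'.fiberToSpecResidueField z) := by
  let s := Z.fromSpecResidueField z
  have hP : IsTrivialAffineBundle n (pullback.snd f (s ≫ i)) := by
    have h1 : IsPullback (pullback.fst f (s ≫ i)) (pullback.snd f (s ≫ i)) f
        (Spec.map (i.residueFieldMap z) ≫ Y.fromSpecResidueField (i z)) := by
      rw [Scheme.Hom.SpecMap_residueFieldMap_fromSpecResidueField]
      exact .of_hasPullback _ _
    have h2 : IsPullback (pullback.fst f (Y.fromSpecResidueField (i z))) (pullback.snd _ _) f
      (Y.fromSpecResidueField (i z)) := .of_hasPullback _ _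
    exact h.of_isPullback (IsPullback.of_right' h1 h2)
  obtain ⟨e, he⟩ := isTrivialAffineBundle_iff.1 hP
  -- The comparison `m` below is a surjective closed immersion of fibres. Its target is an affine
  -- space over a field, hence reduced, and this forces `m` to be an isomorphism.
  have : IsReduced (pullback f (s ≫ i)) := isReduced_of_isOpenImmersion e.hom
  let m : pullback f' s ⟶ pullback f (s ≫ i) :=
    pullback.lift (pullback.fst f' s ≫ i') (pullback.snd f' s)
      (by rw [Category.assoc, hc, pullback.condition_assoc])
  have hm : IsPullback m (pullback.fst f' s) (pullback.fst f (s ≫ i)) i' := by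
    have h1 : IsPullback (pullback.snd f' s) (pullback.fst f' s) (s ≫ i) (f' ≫ i) :=
      (IsPullback.of_isLimit (pullbackIsPullbackOfCompMono f' s i)).flip
    have h2 : IsPullback (pullback.snd f (s ≫ i)) (pullback.fst f (s ≫ i)) (s ≫ i) f :=
      (IsPullback.of_hasPullback _ _).flip
    have hsnd : m ≫ pullback.snd f (s ≫ i) = pullback.snd f' s := pullback.lift_snd _ _ _
    rw [← hc, ← hsnd] at h1
    exact IsPullback.of_right h1 (pullback.lift_fst _ _ _) h2
  have : IsClosedImmersion m := MorphismProperty.of_isPullback hm.flip inferInstance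
  have : Surjective m := by
    refine ⟨fun p ↦ ?_⟩
    have h1 : pullback.fst f (s ≫ i) p ∈ Set.range i' := hr (by
      rw [Set.mem_preimage, ← Scheme.Hom.comp_apply, pullback.condition, ← Category.assoc,
        Scheme.Hom.comp_apply]
      exact ⟨_, rfl⟩)
    obtain ⟨x, hx⟩ := h1
    obtain ⟨w, hw, -⟩ := Scheme.exists_preimage_of_isPullback hm p x hx.symm
    exact ⟨w, hw⟩
  have : IsIso m := isIso_of_isClosedImmersion_of_surjective m
  have hT : IsTrivialAffineBundle n (m ≫ pullback.snd f (s ≫ i)) := hP.iso_comp (asIso m)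
  rw [pullback.lift_snd] at hT
  exact hT

end Fiber

/-! ### The Noetherian induction. -/

section Main

variable {k : Type u} [Field k] [CharZero k] {G : Over (Spec (.of k))} [GrpObj G]

open TopologicalSpace

theorem IsQuasiFinite.comp_isClosedImmersion {Z Y Q : Scheme.{u}} {φ : Y ⟶ Q}
    (hφ : IsQuasiFinite φ) (i : Z ⟶ Y) [IsClosedImmersion i] : IsQuasiFinite (i ≫ φ) := by
  obtain ⟨_, _, h⟩ := hφ
  refine ⟨inferInstance, inferInstance, fun q ↦ ?_⟩
  change (i ⁻¹' (φ ⁻¹' {q})).Finite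
  exact (h q).preimage i.isClosedEmbedding.injective.injOn

/-- There is a nonempty open subset of the quotient over which a morphism with affine space fibres is
a trivial affine bundle. -/
theorem exists_opens_isTrivialAffineBundle {X Y Q : Scheme.{u}} [IsNoetherian Y] [IsReduced Y]
    [Nonempty Y] (f : X ⟶ Y) [LocallyOfFiniteType f] [QuasiCompact f] [QuasiSeparated f] (φ : Y ⟶ Q)
    (hφ : IsQuasiFinite φ) (n : ℕ)
    (hf : ∀ y, IsTrivialAffineBundle n (f.fiberToSpecResidueField y)) :
    ∃ W : Q.Opens, IsTrivialAffineBundle n (f ∣_ (φ ⁻¹ᵁ W)) ∧ ∃ y, φ y ∈ W := by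
  obtain ⟨_, _, hfin⟩ := hφ
  -- Finite type with finite fibres gives discrete fibres, so no point of a fibre properly
  -- specializes to another.
  have : LocallyQuasiFinite φ := .of_finite_preimage_singleton φ hfin
  refine exists_opens_preimage_of_finite_fiber φ φ.continuous hfin ?_
    (fun U ↦ IsTrivialAffineBundle n (f ∣_ U)) ?_ (fun U V hUV hV ↦ hV.morphismRestrict_mono hUV)
    (fun U V hUV hU hV ↦ hU.morphismRestrict_sup hV hUV)
    (fun y hy ↦ exists_isTrivialAffineBundle_morphismRestrict_of_fiber f y n hy (hf y))
  · intro y z hyz h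
    have h1 := φ.isDiscrete_preimage_singleton (φ z)
    have h2 : (⟨y, hyz⟩ : φ ⁻¹' {φ z}) ⤳ ⟨z, rfl⟩ :=
      Topology.IsInducing.subtypeVal.specializes_iff.1 h
    have := h1.to_subtype
    exact congrArg Subtype.val h2.eq
  · have h1 : IsEmpty (⊥ : Y.Opens) := ⟨fun x ↦ x.2⟩
    have h2 : IsEmpty (f ⁻¹ᵁ ⊥ : X.Opens) := ⟨fun x ↦ x.2⟩
    have h3 : IsEmpty 𝔸(ULift.{u} (Fin n); (⊥ : Y.Opens)) :=
      ⟨fun x ↦ h1.elim ((𝔸(ULift.{u} (Fin n); (⊥ : Y.Opens)) ↘ _) x)⟩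
    let e : (f ⁻¹ᵁ ⊥ : X.Opens).toScheme ≅ 𝔸(ULift.{u} (Fin n); (⊥ : Y.Opens)) :=
      isInitialOfIsEmpty.uniqueUpToIso isInitialOfIsEmpty
    exact isTrivialAffineBundle_iff.2 ⟨e, isInitialOfIsEmpty.hom_ext _ _⟩

/-- The varieties change during the induction, so they are measured by their closed images in one
fixed Noetherian space `T`. Of `φ` only invariance and quasi-finiteness are asked: these pass to
closed invariant subvarieties, whereas being a categorical quotient need not. -/
theorem cls_eq_of_isClosedEmbedding [IsAlgebraicGroup G] {T : Type u} [TopologicalSpace T]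
    [NoetherianSpace T] (n : ℕ) (C : Closeds T) :
    ∀ (X Y : GVariety G) (f : X.obj ⟶ Y.obj) (_ : IsModHom G f) (Q : Over (Spec (.of k)))
      (φ : Y.obj ⟶ Q) (_ : γ[G, Y.obj] ≫ φ = snd G Y.obj ≫ φ) (_ : IsQuasiFinite φ.left)
      (_ : ∀ y, IsTrivialAffineBundle n (f.left.fiberToSpecResidueField y))
      (emb : Y.obj.left → T) (_ : Topology.IsClosedEmbedding emb) (_ : Set.range emb = C),
      X.cls = Y.cls * lefschetz G ^ n := by
  induction C using WellFoundedLT.induction with | _ C ih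
  intro X Y f hf Q φ hinv hqf hfib emb hemb hC
  rcases isEmpty_or_nonempty Y.obj.left with hY | hY
  · have : IsEmpty X.obj.left := ⟨fun x ↦ hY.elim (f.left x)⟩
    rw [X.cls_eq_zero, Y.cls_eq_zero, zero_mul]
  have hinvX : γ[G, X.obj] ≫ f ≫ φ = snd G X.obj ≫ f ≫ φ := by
    have h1 : γ[G, X.obj] ≫ f = G ◁ f ≫ γ[G, Y.obj] := hf.smul_hom
    rw [reassoc_of% h1, hinv, whiskerLeft_snd_assoc]
  have := Y.isVariety.isNoetherian
  have := Y.isVariety.isReduced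
  obtain ⟨_, _, _, _⟩ := X.isVariety
  obtain ⟨_, _, _, _⟩ := Y.isVariety
  have : LocallyOfFiniteType (f.left ≫ Y.obj.hom) := by rw [Over.w]; infer_instance
  have : QuasiCompact (f.left ≫ Y.obj.hom) := by rw [Over.w]; infer_instance
  have : IsSeparated (f.left ≫ Y.obj.hom) := by rw [Over.w]; infer_instance
  have : LocallyOfFiniteType f.left := locallyOfFiniteType_of_comp f.left Y.obj.hom
  have : QuasiCompact f.left := .of_comp f.left Y.obj.hom
  have : IsSeparated f.left := .of_comp f.left Y.obj.hom
  obtain ⟨W, hW, y₀, hy₀⟩ := exists_opens_isTrivialAffineBundle f.left φ.left hqf n hfib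
  let U := φ.left ⁻¹ᵁ W
  let j : Over.mk (U.ι ≫ Y.obj.hom) ⟶ Y.obj := Over.homMk U.ι
  let j' : Over.mk ((f.left ⁻¹ᵁ U).ι ≫ X.obj.hom) ⟶ X.obj := Over.homMk (f.left ⁻¹ᵁ U).ι
  have hjo : IsOpenImmersion j.left := inferInstanceAs (IsOpenImmersion U.ι)
  have hjo' : IsOpenImmersion j'.left := inferInstanceAs (IsOpenImmersion (f.left ⁻¹ᵁ U).ι)
  have hrj : Set.range j.left = φ.left ⁻¹' W := U.range_ι
  have hrj' : Set.range j'.left = (f ≫ φ).left ⁻¹' W := (f.left ⁻¹ᵁ U).range_ι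
  obtain ⟨actU, hj⟩ := exists_modObj_of_isOpenImmersion hinv j W hrj
  obtain ⟨actX, hj'⟩ := exists_modObj_of_isOpenImmersion hinvX j' W hrj'
  -- Orbits in `Y` lie in fibres of `φ` and are therefore finite. Orbits in `X` may be infinite;
  -- there goodness comes from the affine morphism `fU`.
  let YU : GVariety G := ⟨_, Y.isVariety.of_isOpenImmersion j, Y.good.of_isOpenImmersion hj
    fun y ↦ (hqf.finite_fiber _).subset (orbit_subset_preimage hinv y)⟩
  let fU : Over.mk ((f.left ⁻¹ᵁ U).ι ≫ X.obj.hom) ⟶ YU.obj :=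
    Over.homMk (f.left ∣_ U) (by
      change f.left ∣_ U ≫ U.ι ≫ Y.obj.hom = (f.left ⁻¹ᵁ U).ι ≫ X.obj.hom
      rw [morphismRestrict_ι_assoc, Over.w])
  have hfUj : fU ≫ j = j' ≫ f := by
    ext1
    exact morphismRestrict_ι _ _
  have : Mono j := mono_of_mono_left j
  have hfU : IsModHom G fU := isModHom_of_comp_mono fU j hj (hfUj ▸ inferInstance)
  have hfUt : IsTrivialAffineBundle n fU.left := hW
  have := hfUt.isAffineHom
  let XU : GVariety G := ⟨_, X.isVariety.of_isOpenImmersion j', YU.good.of_isAffineHom hfU⟩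
  have hU : XU.cls = YU.cls * lefschetz G ^ n :=
    GVariety.cls_eq_mul_lefschetz_pow (E := XU) (X := YU) hfU hfUt
  obtain ⟨Z, i, hi, hi', hri⟩ := Y.exists_isClosedImmersion hinv W.isOpen.isClosed_compl
  obtain ⟨XZ, i', hiX, hiX', hriX⟩ := X.exists_isClosedImmersion hinvX W.isOpen.isClosed_compl
  have hpre : f.left ⁻¹' Set.range i.left = Set.range i'.left := by
    rw [hri, hriX]; rfl
  have := XZ.isVariety.isReduced
  -- `XZ` carries the reduced structure, so `f` restricts to a map into `Z` as soon as it does so on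
  -- points.
  obtain ⟨l, hl⟩ := exists_lift_of_isReduced i.left (i' ≫ f).left (by
    rintro _ ⟨x, rfl⟩
    exact (hpre ▸ ⟨x, rfl⟩ : i'.left x ∈ f.left ⁻¹' Set.range i.left))
  let fZ : XZ.obj ⟶ Z.obj := Over.homMk l (by rw [← Over.w i, reassoc_of% hl]; exact Over.w _)
  have hfZi : fZ ≫ i = i' ≫ f := by
    ext1
    exact hl
  have : Mono i := mono_of_mono_left i
  have hfZ : IsModHom G fZ := isModHom_of_comp_mono fZ i hi (hfZi ▸ inferInstance)
  have hZinv : γ[G, Z.obj] ≫ i ≫ φ = snd G Z.obj ≫ i ≫ φ := by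
    have h1 : γ[G, Z.obj] ≫ i = G ◁ i ≫ γ[G, Y.obj] := hi.smul_hom
    rw [reassoc_of% h1, hinv, whiskerLeft_snd_assoc]
  have hembZ : Topology.IsClosedEmbedding (emb ∘ i.left) := hemb.comp i.left.isClosedEmbedding
  have hZ : XZ.cls = Z.cls * lefschetz G ^ n := by
    refine ih ⟨_, hembZ.isClosed_range⟩ ?_ XZ Z fZ hfZ Q (i ≫ φ) hZinv
      (hqf.comp_isClosedImmersion i.left) (fun z ↦ ?_) _ hembZ rfl
    -- The closed set strictly decreases: `y₀` maps into `W`, so it is not in `Z`.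
    · rw [← SetLike.coe_ssubset_coe, ← hC]
      refine (Set.ssubset_iff_of_subset (Set.range_comp_subset_range _ _)).2 ⟨emb y₀, ⟨y₀, rfl⟩, ?_⟩
      rintro ⟨z, hz⟩
      have h1 : y₀ ∈ φ.left ⁻¹' (W : Set Q.left)ᶜ := hri ▸ ⟨z, hemb.injective hz⟩
      exact h1 hy₀
    · exact isTrivialAffineBundle_fiber_of_isClosedImmersion hl.symm hpre.subset z (hfib _)
  rw [Y.cls_eq_add Z YU i j hi hj hi' hjo (by rw [hrj, hri]; exact (compl_compl _).symm),
    X.cls_eq_add XZ XU i' j' hiX hj' hiX' hjo' (by rw [hrj', hriX]; exact (compl_compl _).symm),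
    hU, hZ, add_mul]

end Main

end EquivariantK0

end

theorem theorem2p3 {k : Type u} [Field k] [CharZero k]
    (G : Over (Spec (.of k))) [GrpObj G] [EquivariantK0.IsAlgebraicGroup G]
    (X Y : EquivariantK0.GVariety G) (f : X.obj ⟶ Y.obj) (hf : IsModHom G f)
    (Q : Over (Spec (.of k))) (φ : Y.obj ⟶ Q)
    (hφ : EquivariantK0.IsCategoricalQuotient G φ) (hqf : EquivariantK0.IsQuasiFinite φ.left)
    (n : ℕ)
    (hfib : ∀ y : Y.obj.left, Nonempty
      (Over.mk (f.left.fiberToSpecResidueField y) ≅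
        Over.mk (𝔸(ULift.{u} (Fin n); Spec (Y.obj.left.residueField y)) ↘
          Spec (Y.obj.left.residueField y)))) :
    X.cls = Y.cls * EquivariantK0.lefschetz G ^ n :=
  have := Y.isVariety.isNoetherian
  -- The ambient Noetherian space is `Y` itself, embedded by the identity.
  EquivariantK0.cls_eq_of_isClosedEmbedding n ⊤ X Y f hf Q φ hφ.invariant hqf hfib id .id
    Set.range_id
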